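/- Let $\mathbb{F}$ be a field of characteristic $2$. A \emph{commutative Lie algebra} over $\mathbb{F}$ is an $\mathbb{F}$-vector space $\mathfrak{g}$ with a bilinear bracket satisfying $[x,y]=[y,x]$ and $[x,[y,z]]+[y,[z,x]]+[z,[x,y]]=0$; a \emph{$\mathfrak{g}$-module} is a vector space $M$ with a bilinear map $\mathfrak{g}\times M\to M$, $(x,m)\mapsto x\cdot m$, such that $[x,y]\cdot m=x\cdot(y\cdot m)+y\cdot(x\cdot m)$. Let $CS^n(\mathfrak{g},M)=\mathrm{Hom}_{\mathbb{F}}(S^n\mathfrak{g},M)$ be the space of symmetric $n$-linear maps $\mathfrak{g}^n\to M$, with the differential $$df(x_1,\dots,x_{n+1})=\sum_{i} x_i\cdot f(\dots,\hat x_i,\dots)+\sum_{i<j} f([x_i,x_j],x_1,\dots,\hat x_i,\dots,\hat x_j,\dots,x_{n+1}),$$ and let $HS^n(\mathfrak{g},M)$ be the cohomology of this complex. Let $0\to\mathfrak{h}\to\mathfrak{g}\to\mathfrak{q}\to 0$ be a short exact sequence of commutative Lie algebras over $\mathbb{F}$ and let $M$ be a $\mathfrak{g}$-module. Let $\mathcal{F}^pCS^n(\mathfrak{g},M)$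 be the space of all $c\in CS^n(\mathfrak{g},M)$ with $c(x_1,\dots,x_n)=0$ whenever at least $n-p+1$ of the $x_i$ belong to $\mathfrak{h}$; this is a decreasing filtration of $CS^\bullet(\mathfrak{g},M)$ by subcomplexes. The action of $\mathfrak{g}$ on $CS^q(\mathfrak{h},M)$ by $(x\cdot f)(y_1,\dots,y_q)=x\cdot f(y_1,\dots,y_q)+\sum_i f(y_1,\dots,[x,y_i],\dots,y_q)$ induces a $\mathfrak{q}$-module structure on $HS^q(\mathfrak{h},M)$. Then the spectral sequence of this filtration, i.e. the first quadrant cohomological spectral sequence with pages $$E_r^{p,q}=Z_r^{p,q}/(Z_{r-1}^{p+1,q-1}+dZ_{r-1}^{p-r+1,q+r-2}),\qquad Z_r^{p,q}=\{c\in\mathcal{F}^pCS^{p+q}(\mathfrak{g},M)\mid dc\in\mathcal{F}^{p+r}CS^{p+q+1}(\mathfrak{g},M)\}\qquad(r\ge 0),$$ with differentials $d_r:E_r^{p,q}\to E_r^{p+r,q-r+1}$ induced by $d$ and with the isomorphisms $H(E_r)\cong E_{r+1}$ that are the identity on representatives in $Z_{r+1}$, has the following properties. 1. For all $p,q\ge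 0$ there is a linear isomorphism $$E_2^{p,q}\cong HS^p(\mathfrak{q},HS^q(\mathfrak{h},M)).$$ It is induced by restriction of cochains: the class of $f\in Z_2^{p,q}$ is sent to the class of a cocycle $\varphi\in CS^p(\mathfrak{q},HS^q(\mathfrak{h},M))$ such that, for all $x_1,\dots,x_p\in\mathfrak{g}$ with images $\bar x_i\in\mathfrak{q}$, the map $(y_1,\dots,y_q)\mapsto f(x_1,\dots,x_p,y_1,\dots,y_q)$ on $\mathfrak{h}^q$ is a cocycle with class $\varphi(\bar x_1,\dots,\bar x_p)$. 2. It converges to $HS^\bullet(\mathfrak{g},M)$: let $\mathcal{F}^pHS^n(\mathfrak{g},M)$ be the space of classes of cocycles in $\mathcal{F}^pCS^n(\mathfrak{g},M)$. Then $\mathcal{F}^0HS^n(\mathfrak{g},M)=HS^n(\mathfrak{g},M)$ and $\mathcal{F}^{n+1}HS^n(\mathfrak{g},M)=0$, and for all $p,q\ge 0$ and all $r>\max(p,q+1)$, sending the class of a cochain in $Z_r^{p,q}$ (which is then a cocycle) to its cohomology class induces an isomorphism $$E_r^{p,q}\cong\mathcal{F}^pHS^{p+q}(\mathfrak{g},M)/\mathcal{F}^{p+1}HS^{p+q}(\mathfrak{g},M).$$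 -/

import Mathlib

open CategoryTheory

/-! ### Commutative Lie algebras, their modules and extensions -/

/-- A commutative Lie algebra over `𝔽`: a bilinear bracket which is symmetric and satisfies the
Jacobi identity (`[x, x] = 0` is not required). Meant for fields of characteristic `2`. -/
class CommLieAlgebra (𝔽 L : Type*) [Field 𝔽] [AddCommGroup L] [Module 𝔽 L] where
  bracket : L →ₗ[𝔽] L →ₗ[𝔽] L
  bracket_comm : ∀ x y, bracket x y = bracket y x
  jacobi : ∀ x y z,
    bracket x (bracket y z) + bracket y (bracket z x) + bracket z (bracket x y) = 0

/-- The bracket `(x, y) ↦ [x, y]` of a commutative Lie algebra, as a bilinear map. -/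
abbrev lieBr (𝔽 : Type*) {L : Type*} [Field 𝔽] [AddCommGroup L] [Module 𝔽 L]
    [CommLieAlgebra 𝔽 L] : L →ₗ[𝔽] L →ₗ[𝔽] L :=
  CommLieAlgebra.bracket

/-- The structure of an `L`-module on the vector space `M`:
`[x, y] · m = x · (y · m) + y · (x · m)`. -/
structure CommLieRep (𝔽 L M : Type*) [Field 𝔽] [AddCommGroup L] [Module 𝔽 L]
    [CommLieAlgebra 𝔽 L] [AddCommGroup M] [Module 𝔽 M] where
  act : L →ₗ[𝔽] M →ₗ[𝔽] M
  act_bracket : ∀ x y m, act (lieBr 𝔽 x y) m = act x (act y m) + act y (act x m)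

/-- An extension `0 → h → g → q → 0` of commutative Lie algebras. -/
structure CommLieExtension (𝔽 h g q : Type*) [Field 𝔽]
    [AddCommGroup h] [Module 𝔽 h] [CommLieAlgebra 𝔽 h]
    [AddCommGroup g] [Module 𝔽 g] [CommLieAlgebra 𝔽 g]
    [AddCommGroup q] [Module 𝔽 q] [CommLieAlgebra 𝔽 q] where
  incl : h →ₗ[𝔽] g
  proj : g →ₗ[𝔽] q
  incl_bracket : ∀ x y, incl (lieBr 𝔽 x y) = lieBr 𝔽 (incl x) (incl y)
  proj_bracket : ∀ x y, proj (lieBr 𝔽 x y) = lieBr 𝔽 (proj x) (proj y)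
  incl_injective : Function.Injective incl
  exact : Function.Exact incl proj
  proj_surjective : Function.Surjective proj

/-! ### Multilinear cochains and the Cartan calculus -/

namespace CommLie

section Multilinear

variable {𝔽 L M : Type*} [Field 𝔽] [AddCommGroup L] [Module 𝔽 L] [AddCommGroup M] [Module 𝔽 M]

theorem add_self [CharP 𝔽 2] (m : M) : m + m = 0 := by
  rw [← two_smul 𝔽 m, CharTwo.two_eq_zero, zero_smul]

theorem add_cancel_mid [CharP 𝔽 2] (a b c : M) : (a + b) + (b + c) = a + c := by
  have := add_self (𝔽 := 𝔽) b
  calc (a + b) + (b + c) = a + c + (b + b) := by abel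
    _ = a + c := by rw [this, add_zero]

variable (𝔽 L M) in
/-- `n`-linear maps `L × ⋯ × L → M`. -/
abbrev ML (n : ℕ) := MultilinearMap 𝔽 (fun _ : Fin n => L) M

/-- For endomorphisms `A` of `M` and `D` of `L`, the operator
`(θ f)(y₁, …, yₙ) = A f(y₁, …, yₙ) + ∑ᵢ f(y₁, …, D yᵢ, …, yₙ)`. -/
def theta (A : M →ₗ[𝔽] M) (D : L →ₗ[𝔽] L) (n : ℕ) : ML 𝔽 L M n →ₗ[𝔽] ML 𝔽 L M n where
  toFun f := A.compMultilinearMap f +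
    ∑ i, f.compLinearMap (Function.update (fun _ => LinearMap.id) i D)
  map_add' f g := by
    ext y
    simp [Finset.sum_add_distrib]
    abel
  map_smul' c f := by
    ext y
    simp [Finset.smul_sum]

theorem theta_apply (A : M →ₗ[𝔽] M) (D : L →ₗ[𝔽] L) (n : ℕ) (f : ML 𝔽 L M n) (y : Fin n → L) :
    theta A D n f y = A (f y) + ∑ i, f (Function.update y i (D (y i))) := by
  simp only [theta, LinearMap.coe_mk, AddHom.coe_mk, add_apply,
    LinearMap.compMultilinearMap_apply, sum_apply, MultilinearMap.compLinearMap_apply]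
  congr 1
  refine Finset.sum_congr rfl fun i _ => ?_
  congr 1
  funext j
  by_cases hj : j = i
  · subst hj; simp
  · simp [hj]

theorem theta_zero_apply (A : M →ₗ[𝔽] M) (D : L →ₗ[𝔽] L) (f : ML 𝔽 L M 0) (y : Fin 0 → L) :
    theta A D 0 f y = A (f y) := by
  simp [theta_apply]

/-- The insertion operator `(i_x f)(y₁, …, yₙ) = f(x, y₁, …, yₙ)`. -/
def ins (x : L) (n : ℕ) : ML 𝔽 L M (n + 1) →ₗ[𝔽] ML 𝔽 L M n where
  toFun f := f.curryLeft x
  map_add' _ _ := rfl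
  map_smul' _ _ := rfl

theorem ins_apply (x : L) (n : ℕ) (f : ML 𝔽 L M (n + 1)) (y : Fin n → L) :
    ins x n f y = f (Fin.cons x y) := rfl

theorem ins_add (x x' : L) (n : ℕ) (f : ML 𝔽 L M (n + 1)) :
    ins (x + x') n f = ins x n f + ins x' n f :=
  map_add f.curryLeft x x'

theorem ins_smul (c : 𝔽) (x : L) (n : ℕ) (f : ML 𝔽 L M (n + 1)) :
    ins (c • x) n f = c • ins x n f :=
  map_smul f.curryLeft c x

theorem ext_ins {n : ℕ} {f g : ML 𝔽 L M (n + 1)} (h : ∀ x, ins x n f = ins x n g) : f = g := by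
  ext y
  have := congrArg (fun F : ML 𝔽 L M n => F (Fin.tail y)) (h (y 0))
  simpa [ins_apply] using this

theorem ins_theta (A : M →ₗ[𝔽] M) (D : L →ₗ[𝔽] L) (n : ℕ) (f : ML 𝔽 L M (n + 1)) (x : L) :
    ins x n (theta A D (n + 1) f) = theta A D n (ins x n f) + ins (D x) n f := by
  ext y
  simp only [ins_apply, theta_apply, add_apply,
    Fin.sum_univ_succ, Fin.cons_zero, Fin.cons_succ, Fin.cons_update, Fin.update_cons_zero]
  abel

theorem theta_add (A A' : M →ₗ[𝔽] M) (D D' : L →ₗ[𝔽] L) (n : ℕ) (f : ML 𝔽 L M n) :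
    theta (A + A') (D + D') n f = theta A D n f + theta A' D' n f := by
  ext y
  simp only [theta_apply, add_apply, LinearMap.add_apply,
    MultilinearMap.map_update_add, Finset.sum_add_distrib]
  abel

theorem theta_smul (c : 𝔽) (A : M →ₗ[𝔽] M) (D : L →ₗ[𝔽] L) (n : ℕ) (f : ML 𝔽 L M n) :
    theta (c • A) (c • D) n f = c • theta A D n f := by
  ext y
  simp only [theta_apply, smul_apply, LinearMap.smul_apply,
    MultilinearMap.map_update_smul, smul_add, Finset.smul_sum]

theorem theta_comm [CharP 𝔽 2] (A A' : M →ₗ[𝔽] M) (D D' : L →ₗ[𝔽] L) (n : ℕ) (f : ML 𝔽 L M n) :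
    theta A D n (theta A' D' n f) + theta A' D' n (theta A D n f) =
      theta (A ∘ₗ A' + A' ∘ₗ A) (D ∘ₗ D' + D' ∘ₗ D) n f := by
  induction n with
  | zero =>
    ext y
    simp [theta_zero_apply]
  | succ n ih =>
    refine ext_ins fun x => ?_
    rw [ins_theta, ← ih]
    simp only [ins_theta, map_add, LinearMap.add_apply, LinearMap.comp_apply, ins_add]
    have h1 := add_self (𝔽 := 𝔽) (theta A D n (ins (D' x) n f))
    have h2 := add_self (𝔽 := 𝔽) (theta A' D' n (ins (D x) n f))
    linear_combination (norm := module) h1 + h2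

variable [CommLieAlgebra 𝔽 L] (ρ : CommLieRep 𝔽 L M)

/-- The Lie derivative
`(L_x f)(y₁, …, yₙ) = x · f(y₁, …, yₙ) + ∑ᵢ f(y₁, …, [x, yᵢ], …, yₙ)`. -/
abbrev lieDer (x : L) (n : ℕ) : ML 𝔽 L M n →ₗ[𝔽] ML 𝔽 L M n :=
  theta (ρ.act x) (lieBr 𝔽 x) n

/-- The Chevalley-Eilenberg formula
`∑ᵢ xᵢ · f(x₀, …, x̂ᵢ, …, xₙ) + ∑_{i < j} f(x₀, …, x̂ᵢ, …, [xᵢ, xⱼ], …, xₙ)`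
with `[xᵢ, xⱼ]` in the place of `xⱼ`. The indices `j > i` are written as `i.succAbove j`. For
symmetric `f` the place of `[xᵢ, xⱼ]` does not matter; see `CommLie.ceSum_eq_of_symmetric`. -/
def ceSum {n : ℕ} (f : (Fin n → L) → M) (x : Fin (n + 1) → L) : M :=
  ∑ i, ρ.act (x i) (f (i.removeNth x)) +
    ∑ i, ∑ j, if i < i.succAbove j then
      f (Function.update (i.removeNth x) j (lieBr 𝔽 (x i) (x (i.succAbove j)))) else 0

theorem ceSum_cons {n : ℕ} (f : ML 𝔽 L M (n + 1)) (x : L) (y : Fin (n + 1) → L) :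
    ceSum ρ f (Fin.cons x y : Fin (n + 2) → L) = lieDer ρ x (n + 1) f y + ceSum ρ (ins x n f) y := by
  have hrem : ∀ i : Fin (n + 1), (i.succ.removeNth (Fin.cons x y : Fin (n + 2) → L)) =
      (Fin.cons x (i.removeNth y) : Fin (n + 1) → L) := by
    intro i
    funext k
    refine Fin.cases ?_ (fun k => ?_) k <;> simp [Fin.removeNth]
  simp only [ceSum, theta_apply]
  rw [Fin.sum_univ_succ, Fin.sum_univ_succ (f := fun i : Fin (n + 2) => ∑ j : Fin (n + 1), _)]
  simp only [hrem, Fin.removeNth_zero, Fin.tail_cons, Fin.cons_zero, Fin.cons_succ, ins_apply]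
  have h0 : ∀ i : Fin (n + 1), (∑ j : Fin (n + 1), if i.succ < i.succ.succAbove j then
      f (Function.update (Fin.cons x (i.removeNth y) : Fin (n + 1) → L) j
        (lieBr 𝔽 (y i) ((Fin.cons x y : Fin (n + 2) → L) (i.succ.succAbove j)))) else 0) =
      ∑ j : Fin n, if i < i.succAbove j then
        f (Fin.cons x (Function.update (i.removeNth y) j (lieBr 𝔽 (y i) (y (i.succAbove j)))))
        else 0 := by
    intro i
    rw [Fin.sum_univ_succ]
    simp [Fin.cons_update]
  simp only [h0]
  simp
  abel

theorem ceSum_zero (f : ML 𝔽 L M 0) (x : Fin 1 → L) :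
    ceSum ρ f x = lieDer ρ (x 0) 0 f (Fin.tail x) := by
  simp [ceSum, theta_apply]

/-- The Chevalley-Eilenberg differential, built by recursion on the number of arguments. -/
def ceAux : (n : ℕ) → ML 𝔽 L M n →ₗ[𝔽] ML 𝔽 L M (n + 1)
  | 0 =>
    { toFun := fun f => LinearMap.uncurryLeft
        { toFun := fun x => lieDer ρ x 0 f
          map_add' := fun x y => by rw [lieDer, map_add, map_add, theta_add]
          map_smul' := fun c x => by rw [lieDer, map_smul, map_smul, theta_smul]; rfl }
      map_add' := fun f g => by ext; simp
      map_smul' := fun c f => by ext; simp }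
  | n + 1 =>
    { toFun := fun f => LinearMap.uncurryLeft
        { toFun := fun x => lieDer ρ x (n + 1) f + ceAux n (ins x n f)
          map_add' := fun x y => by
            rw [lieDer, map_add, map_add, theta_add, ins_add, map_add]; abel
          map_smul' := fun c x => by
            rw [lieDer, map_smul, map_smul, theta_smul, ins_smul, map_smul, ← smul_add]; rfl }
      map_add' := fun f g => by ext; simp; abel
      map_smul' := fun c f => by ext; simp }

theorem ceAux_apply (n : ℕ) (f : ML 𝔽 L M n) (x : Fin (n + 1) → L) :
    ceAux ρ n f x = ceSum ρ f x := by
  induction n with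
  | zero => rw [ceSum_zero]; rfl
  | succ n ih =>
    obtain ⟨x0, y, rfl⟩ : ∃ x0 y, x = Fin.cons x0 y := ⟨x 0, Fin.tail x, (Fin.cons_self_tail x).symm⟩
    rw [ceSum_cons, ← ih]
    simp [ceAux]

/-- The Chevalley-Eilenberg differential on multilinear cochains. -/
def ce (n : ℕ) : ML 𝔽 L M n →ₗ[𝔽] ML 𝔽 L M (n + 1) where
  toFun f :=
    { toFun := fun x => ceSum ρ f x
      map_update_add' := fun x i a b => by
        simp only [← ceAux_apply]
        convert! (ceAux ρ n f).map_update_add x i a b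
      map_update_smul' := fun x i c a => by
        simp only [← ceAux_apply]
        convert! (ceAux ρ n f).map_update_smul x i c a }
  map_add' f g := by
    ext x
    change ceSum ρ (f + g : ML 𝔽 L M n) x = ceSum ρ f x + ceSum ρ g x
    rw [← ceAux_apply, ← ceAux_apply, ← ceAux_apply, map_add]
    rfl
  map_smul' c f := by
    ext x
    change ceSum ρ (c • f : ML 𝔽 L M n) x = c • ceSum ρ f x
    rw [← ceAux_apply, ← ceAux_apply, map_smul]
    rfl

theorem ce_apply (n : ℕ) (f : ML 𝔽 L M n) (x : Fin (n + 1) → L) : ce ρ n f x = ceSum ρ f x := rfl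

theorem ins_ce_zero (f : ML 𝔽 L M 0) (x : L) : ins x 0 (ce ρ 0 f) = lieDer ρ x 0 f := by
  ext y
  rw [ins_apply, ce_apply, ceSum_zero, Fin.tail_cons, Fin.cons_zero]

/-- Cartan's formula `i_x d + d i_x = L_x` (in characteristic `2`). -/
theorem ins_ce_succ (n : ℕ) (f : ML 𝔽 L M (n + 1)) (x : L) :
    ins x (n + 1) (ce ρ (n + 1) f) = lieDer ρ x (n + 1) f + ce ρ n (ins x n f) := by
  ext y
  rw [ins_apply, ce_apply, ceSum_cons]
  rfl

/-- `A`, `D` is a compatible pair: `D` is a derivation of `L` and `A (y · m) = y · A m + D y · m`. -/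
structure IsDerPair (A : M →ₗ[𝔽] M) (D : L →ₗ[𝔽] L) : Prop where
  der : ∀ x y, D (lieBr 𝔽 x y) = lieBr 𝔽 (D x) y + lieBr 𝔽 x (D y)
  act : ∀ y m, A (ρ.act y m) = ρ.act y (A m) + ρ.act (D y) m

variable {ρ}

theorem IsDerPair.theta_lieDer [CharP 𝔽 2] {A : M →ₗ[𝔽] M} {D : L →ₗ[𝔽] L}
    (h : IsDerPair ρ A D) (n : ℕ) (x : L) (f : ML 𝔽 L M n) :
    theta A D n (lieDer ρ x n f) = lieDer ρ x n (theta A D n f) + lieDer ρ (D x) n f := by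
  have h1 : A ∘ₗ ρ.act x + ρ.act x ∘ₗ A = ρ.act (D x) := by
    ext m
    have := add_self (𝔽 := 𝔽) (ρ.act x (A m))
    simp only [LinearMap.add_apply, LinearMap.comp_apply, h.act]
    linear_combination (norm := module) this
  have h2 : D ∘ₗ lieBr 𝔽 x + lieBr 𝔽 x ∘ₗ D = lieBr 𝔽 (D x) := by
    ext y
    have := add_self (𝔽 := 𝔽) (lieBr 𝔽 x (D y))
    simp only [LinearMap.add_apply, LinearMap.comp_apply, h.der]
    linear_combination (norm := module) this
  have h3 := theta_comm A (ρ.act x) D (lieBr 𝔽 x) n f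
  rw [h1, h2] at h3
  have h4 := add_self (𝔽 := 𝔽) (lieDer ρ x n (theta A D n f))
  rw [← h3]
  linear_combination (norm := module) -h4

theorem IsDerPair.theta_ce [CharP 𝔽 2] {A : M →ₗ[𝔽] M} {D : L →ₗ[𝔽] L}
    (h : IsDerPair ρ A D) (n : ℕ) (f : ML 𝔽 L M n) :
    theta A D (n + 1) (ce ρ n f) = ce ρ n (theta A D n f) := by
  induction n with
  | zero =>
    refine ext_ins fun x => ?_
    rw [ins_theta, ins_ce_zero, ins_ce_zero, ins_ce_zero, h.theta_lieDer]
    have h1 := add_self (𝔽 := 𝔽) (lieDer ρ (D x) 0 f)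
    linear_combination (norm := module) h1
  | succ n ih =>
    refine ext_ins fun x => ?_
    rw [ins_theta, ins_ce_succ, ins_ce_succ, ins_ce_succ, map_add, ih, h.theta_lieDer, ins_theta,
      map_add]
    have h1 := add_self (𝔽 := 𝔽) (lieDer ρ (D x) (n + 1) f)
    linear_combination (norm := module) h1

variable (ρ)

theorem isDerPair_lieDer [CharP 𝔽 2] (x : L) : IsDerPair ρ (ρ.act x) (lieBr 𝔽 x) where
  der y z := by
    have h := CommLieAlgebra.jacobi (𝔽 := 𝔽) x y z
    have h1 := add_self (𝔽 := 𝔽) (lieBr 𝔽 (lieBr 𝔽 x y) z)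
    have h2 := add_self (𝔽 := 𝔽) (lieBr 𝔽 y (lieBr 𝔽 x z))
    rw [CommLieAlgebra.bracket_comm z x, CommLieAlgebra.bracket_comm z] at h
    linear_combination (norm := module) h - h1 - h2
  act y m := by
    rw [ρ.act_bracket]
    have h2 := add_self (𝔽 := 𝔽) (ρ.act y (ρ.act x m))
    linear_combination (norm := module) -h2

theorem ce_ce [CharP 𝔽 2] (n : ℕ) (f : ML 𝔽 L M n) : ce ρ (n + 1) (ce ρ n f) = 0 := by
  induction n with
  | zero =>
    refine ext_ins fun x => ?_
    rw [ins_ce_succ, ins_ce_zero, (isDerPair_lieDer ρ x).theta_ce, add_self (𝔽 := 𝔽), map_zero]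
  | succ n ih =>
    refine ext_ins fun x => ?_
    rw [ins_ce_succ, ins_ce_succ, map_add, ih, add_zero, (isDerPair_lieDer ρ x).theta_ce,
      add_self (𝔽 := 𝔽), map_zero]

end Multilinear

/-! ### Symmetric cochains -/

section Symmetric

variable {𝔽 L M : Type*} [Field 𝔽] [AddCommGroup L] [Module 𝔽 L] [AddCommGroup M] [Module 𝔽 M]

variable (𝔽 L M) in
/-- `CSⁿ(L, M) = Hom(Sⁿ L, M)`: the symmetric `n`-linear maps `L × ⋯ × L → M`. -/
def CS (n : ℕ) : Submodule 𝔽 (ML 𝔽 L M n) where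
  carrier := {f | ∀ (σ : Equiv.Perm (Fin n)) (x : Fin n → L), f (x ∘ σ) = f x}
  add_mem' := fun hf hg σ x => by simp [hf σ x, hg σ x]
  zero_mem' := fun σ x => rfl
  smul_mem' := fun c f hf σ x => by simp [hf σ x]

theorem mem_CS {n : ℕ} {f : ML 𝔽 L M n} :
    f ∈ CS 𝔽 L M n ↔ ∀ (σ : Equiv.Perm (Fin n)) (x : Fin n → L), f (x ∘ σ) = f x := Iff.rfl

theorem ins_mem_CS {n : ℕ} {f : ML 𝔽 L M (n + 1)} (hf : f ∈ CS 𝔽 L M (n + 1)) (x : L) :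
    ins x n f ∈ CS 𝔽 L M n := by
  intro σ y
  rw [ins_apply, ins_apply, ← hf (Equiv.Perm.decomposeFin.symm (0, σ)) (Fin.cons x y)]
  congr 1
  funext k
  refine Fin.cases ?_ (fun k => ?_) k <;> simp

theorem ins_ins_of_mem_CS {n : ℕ} {f : ML 𝔽 L M (n + 2)} (hf : f ∈ CS 𝔽 L M (n + 2)) (x y : L) :
    ins x n (ins y (n + 1) f) = ins y n (ins x (n + 1) f) := by
  ext z
  rw [ins_apply, ins_apply, ins_apply, ins_apply, ← hf (Equiv.swap 0 1)]
  congr 1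
  funext k
  refine Fin.cases ?_ (fun k => Fin.cases ?_ (fun k => ?_) k) k
  · simp
  · simp
  · have h1 : Equiv.swap (0 : Fin (n + 2)) 1 k.succ.succ = k.succ.succ :=
      Equiv.swap_apply_of_ne_of_ne (Fin.succ_ne_zero _)
        (by intro h; rw [← Fin.succ_zero_eq_one] at h
            exact Fin.succ_ne_zero _ (Fin.succ_injective _ h))
    simp [h1]

theorem mem_CS_zero (f : ML 𝔽 L M 0) : f ∈ CS 𝔽 L M 0 := by
  intro σ x
  congr 1
  exact Subsingleton.elim _ _

theorem mem_CS_one (f : ML 𝔽 L M 1) : f ∈ CS 𝔽 L M 1 := by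
  intro σ x
  rw [Subsingleton.elim σ 1]; rfl

theorem mem_CS_of_ins {n : ℕ} {f : ML 𝔽 L M (n + 2)} (h1 : ∀ x, ins x (n + 1) f ∈ CS 𝔽 L M (n + 1))
    (h2 : ∀ x y, ins x n (ins y (n + 1) f) = ins y n (ins x (n + 1) f)) : f ∈ CS 𝔽 L M (n + 2) := by
  intro σ
  have hσ : σ ∈ Submonoid.closure
      (Set.range fun i : Fin (n + 1) => Equiv.swap i.castSucc i.succ) := by
    rw [Equiv.Perm.mclosure_swap_castSucc_succ]; trivial
  induction hσ using Submonoid.closure_induction with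
  | one => intro x; rfl
  | mul a b _ _ ha hb =>
    intro x
    have : x ∘ ⇑(a * b) = (x ∘ a) ∘ b := rfl
    rw [this, hb, ha]
  | mem s hs =>
    obtain ⟨i, rfl⟩ := hs
    intro x
    obtain ⟨x0, y, rfl⟩ : ∃ x0 y, x = Fin.cons x0 y := ⟨x 0, Fin.tail x, (Fin.cons_self_tail x).symm⟩
    revert i
    refine Fin.cases ?_ fun i => ?_
    · obtain ⟨x1, z, rfl⟩ : ∃ x1 z, y = Fin.cons x1 z :=
        ⟨y 0, Fin.tail y, (Fin.cons_self_tail y).symm⟩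
      have h := congrArg (fun F : ML 𝔽 L M n => F z) (h2 x0 x1)
      simp only [ins_apply] at h
      rw [← h]
      congr 1
      funext k
      refine Fin.cases ?_ (fun k => Fin.cases ?_ (fun k => ?_) k) k
      · simp
      · simp
      · have h1 : Equiv.swap (0 : Fin (n + 2)) 1 k.succ.succ = k.succ.succ :=
          Equiv.swap_apply_of_ne_of_ne (Fin.succ_ne_zero _)
            (by intro h; rw [← Fin.succ_zero_eq_one] at h
                exact Fin.succ_ne_zero _ (Fin.succ_injective _ h))
        simp [h1]
    · have h := h1 x0 (Equiv.swap i.castSucc i.succ) y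
      rw [ins_apply, ins_apply] at h
      rw [← h]
      congr 1
      funext k
      refine Fin.cases ?_ (fun k => ?_) k
      · have : Equiv.swap (i.succ.castSucc : Fin (n + 2)) i.succ.succ 0 = 0 :=
          Equiv.swap_apply_of_ne_of_ne (by rw [← Fin.succ_castSucc]; exact (Fin.succ_ne_zero _).symm)
            (Fin.succ_ne_zero _).symm
        simp only [Function.comp_apply, this, Fin.cons_zero]
      · have : Equiv.swap (i.succ.castSucc : Fin (n + 2)) i.succ.succ k.succ =
            (Equiv.swap i.castSucc i.succ k).succ := by
          rw [← Fin.succ_castSucc]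
          exact (Fin.succ_injective (n + 1)).swap_apply _ _ _
        simp only [Function.comp_apply, this, Fin.cons_succ]

theorem theta_mem_CS (A : M →ₗ[𝔽] M) (D : L →ₗ[𝔽] L) {n : ℕ} {f : ML 𝔽 L M n}
    (hf : f ∈ CS 𝔽 L M n) : theta A D n f ∈ CS 𝔽 L M n := by
  intro σ x
  rw [theta_apply, theta_apply, hf]
  congr 1
  rw [← Equiv.sum_comp σ fun i => f (Function.update x i (D (x i)))]
  refine Finset.sum_congr rfl fun i _ => ?_
  rw [← hf σ (Function.update x (σ i) _)]
  congr 1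
  rw [Function.update_comp_equiv]
  simp

variable [CommLieAlgebra 𝔽 L] (ρ : CommLieRep 𝔽 L M)

theorem ce_mem_CS {n : ℕ} {f : ML 𝔽 L M n} (hf : f ∈ CS 𝔽 L M n) :
    ce ρ n f ∈ CS 𝔽 L M (n + 1) := by
  induction n with
  | zero => exact mem_CS_one _
  | succ n ih =>
    refine mem_CS_of_ins (fun x => ?_) fun x y => ?_
    · rw [ins_ce_succ]
      exact add_mem (theta_mem_CS _ _ hf) (ih (ins_mem_CS hf x))
    · rw [ins_ce_succ, ins_ce_succ, map_add, map_add, ins_theta, ins_theta]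
      cases n with
      | zero =>
        rw [ins_ce_zero, ins_ce_zero, CommLieAlgebra.bracket_comm y x]
        abel
      | succ n =>
        rw [ins_ce_succ, ins_ce_succ, CommLieAlgebra.bracket_comm y x, ins_ins_of_mem_CS hf]
        abel

/-- For symmetric `f`, the formula defining the differential is the usual one,
`∑ᵢ xᵢ · f(…, x̂ᵢ, …) + ∑_{i < j} f([xᵢ, xⱼ], …, x̂ᵢ, …, x̂ⱼ, …)`. -/
theorem ceSum_eq_of_symmetric {n : ℕ} {f : ML 𝔽 L M (n + 1)} (hf : f ∈ CS 𝔽 L M (n + 1))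
    (x : Fin (n + 2) → L) :
    ceSum ρ f x = ∑ i, ρ.act (x i) (f (i.removeNth x)) +
      ∑ i, ∑ j, if i < i.succAbove j then
        f (Fin.cons (lieBr 𝔽 (x i) (x (i.succAbove j))) (j.removeNth (i.removeNth x))) else 0 := by
  have h : ∀ (y : Fin (n + 1) → L) (j : Fin (n + 1)) (b : L),
      f (Function.update y j b) = f (Fin.cons b (j.removeNth y)) := by
    intro y j b
    rw [← hf j.cycleRange (Fin.cons b (j.removeNth y)), Fin.cons_comp_cycleRange,
      Fin.insertNth_removeNth]
  simp only [ceSum, h]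

end Symmetric

/-! ### The cochain complex and commutative cohomology -/

section Cohomology

universe u v w

variable {𝔽 : Type u} {L : Type v} {M : Type w} [Field 𝔽] [AddCommGroup L] [Module 𝔽 L]
  [AddCommGroup M] [Module 𝔽 M] [CommLieAlgebra 𝔽 L]

/-- The Chevalley-Eilenberg differential `CSⁿ(L, M) → CSⁿ⁺¹(L, M)`. -/
def dCS (ρ : CommLieRep 𝔽 L M) (n : ℕ) : CS 𝔽 L M n →ₗ[𝔽] CS 𝔽 L M (n + 1) :=
  (ce ρ n).restrict fun _ hf => ce_mem_CS ρ hf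

variable [CharP 𝔽 2]

/-- The cochain complex `CS^•(L, M)`. -/
noncomputable def csComplex (ρ : CommLieRep 𝔽 L M) : CochainComplex (ModuleCat.{max v w} 𝔽) ℕ :=
  CochainComplex.of (fun n => ModuleCat.of 𝔽 (CS 𝔽 L M n)) (fun n => ModuleCat.ofHom (dCS ρ n))
    fun n => by
      ext f : 3
      exact ce_ce ρ n _

/-- A degree `n` element of the cochain complex, as an `n`-linear map. -/
def ev (ρ : CommLieRep 𝔽 L M) (n : ℕ) : (csComplex ρ).X n →ₗ[𝔽] ML 𝔽 L M n :=
  (CS 𝔽 L M n).subtype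

theorem ev_injective (ρ : CommLieRep 𝔽 L M) (n : ℕ) : Function.Injective (ev ρ n) :=
  Subtype.val_injective

theorem ev_mem (ρ : CommLieRep 𝔽 L M) (n : ℕ) (f : (csComplex ρ).X n) : ev ρ n f ∈ CS 𝔽 L M n :=
  Subtype.property (p := fun f => f ∈ CS 𝔽 L M n) f

theorem csComplex_d (ρ : CommLieRep 𝔽 L M) (n : ℕ) :
    (csComplex ρ).d n (n + 1) = ModuleCat.ofHom (dCS ρ n) :=
  CochainComplex.of_d (fun n => ModuleCat.of 𝔽 (CS 𝔽 L M n)) (fun n => ModuleCat.ofHom (dCS ρ n)) n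

theorem ev_d (ρ : CommLieRep 𝔽 L M) (n : ℕ) (f : (csComplex ρ).X n) :
    ev ρ (n + 1) ((csComplex ρ).d n (n + 1) f) = ce ρ n (ev ρ n f) := by
  rw [csComplex_d]; rfl

/-- Commutative cohomology `HSⁿ(L, M)`. -/
noncomputable abbrev HS (ρ : CommLieRep 𝔽 L M) (n : ℕ) : ModuleCat.{max v w} 𝔽 :=
  (csComplex ρ).homology n

/-- The cochain map `θ` attached to a compatible pair of endomorphisms of `M` and `L`. -/
noncomputable def thetaHom {ρ : CommLieRep 𝔽 L M} {A : M →ₗ[𝔽] M} {D : L →ₗ[𝔽] L}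
    (h : IsDerPair ρ A D) : csComplex ρ ⟶ csComplex ρ :=
  CochainComplex.ofHom
    (fun n => ModuleCat.ofHom ((theta A D n).restrict fun _ hf => theta_mem_CS A D hf :
      CS 𝔽 L M n →ₗ[𝔽] CS 𝔽 L M n))
    fun n => by
      rw [csComplex_d]
      ext f : 2
      exact Subtype.ext (h.theta_ce n _).symm

theorem ev_thetaHom {ρ : CommLieRep 𝔽 L M} {A : M →ₗ[𝔽] M} {D : L →ₗ[𝔽] L}
    (h : IsDerPair ρ A D) (n : ℕ) (f : (csComplex ρ).X n) :
    ev ρ n ((thetaHom h).f n f) = theta A D n (ev ρ n f) := rfl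

/-- By Cartan's formula, `L` acts trivially on its cohomology. -/
theorem homologyMap_lieDer (ρ : CommLieRep 𝔽 L M) (x : L) (n : ℕ)
    (h : IsDerPair ρ (ρ.act x) (lieBr 𝔽 x)) :
    HomologicalComplex.homologyMap (thetaHom h) n = 0 := by
  rw [← cancel_epi ((csComplex ρ).homologyπ n), HomologicalComplex.homologyπ_naturality,
    Limits.comp_zero]
  have hk : ∀ k, ce ρ n (ev ρ n ((csComplex ρ).iCycles n k)) = 0 := fun k => by
    rw [← ev_d, ← ModuleCat.comp_apply, HomologicalComplex.iCycles_d]; rfl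
  cases n with
  | zero =>
    suffices HomologicalComplex.cyclesMap (thetaHom h) 0 = 0 by rw [this, Limits.zero_comp]
    rw [← cancel_mono ((csComplex ρ).iCycles 0), HomologicalComplex.cyclesMap_i, Limits.zero_comp]
    ext k : 2
    refine ev_injective ρ 0 ?_
    have h1 := ins_ce_zero ρ (ev ρ 0 ((csComplex ρ).iCycles 0 k)) x
    rw [hk, map_zero] at h1
    exact h1.symm
  | succ n =>
    let ix : (csComplex ρ).X (n + 1) ⟶ (csComplex ρ).X n :=
      ModuleCat.ofHom ((ins x n).restrict fun f (hf : f ∈ CS 𝔽 L M (n + 1)) => ins_mem_CS hf x :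
        CS 𝔽 L M (n + 1) →ₗ[𝔽] CS 𝔽 L M n)
    suffices HomologicalComplex.cyclesMap (thetaHom h) (n + 1) =
        (csComplex ρ).iCycles (n + 1) ≫ ix ≫ (csComplex ρ).toCycles n (n + 1) by
      rw [this, Category.assoc, Category.assoc, HomologicalComplex.toCycles_comp_homologyπ,
        Limits.comp_zero, Limits.comp_zero]
    rw [← cancel_mono ((csComplex ρ).iCycles (n + 1)), HomologicalComplex.cyclesMap_i,
      Category.assoc, Category.assoc, HomologicalComplex.toCycles_i]
    ext k : 2
    refine ev_injective ρ (n + 1) ?_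
    have h1 := ins_ce_succ ρ n (ev ρ (n + 1) ((csComplex ρ).iCycles (n + 1) k)) x
    rw [hk, map_zero] at h1
    have h2 := add_self (𝔽 := 𝔽)
      (ce ρ n (ins x n (ev ρ (n + 1) ((csComplex ρ).iCycles (n + 1) k))))
    have h3 := add_right_cancel (h1.symm.trans h2.symm)
    have h4 := ev_d ρ n (ix ((csComplex ρ).iCycles (n + 1) k))
    exact Eq.trans h3 (Eq.symm h4)

end Cohomology

/-! ### The action of the quotient on the cohomology of the ideal -/

section Extension

universe u vh vg vq w

variable {𝔽 : Type u} {h : Type vh} {g : Type vg} {q : Type vq} {M : Type w} [Field 𝔽]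
  [AddCommGroup h] [Module 𝔽 h] [CommLieAlgebra 𝔽 h]
  [AddCommGroup g] [Module 𝔽 g] [CommLieAlgebra 𝔽 g]
  [AddCommGroup q] [Module 𝔽 q] [CommLieAlgebra 𝔽 q]
  [AddCommGroup M] [Module 𝔽 M]
  (e : CommLieExtension 𝔽 h g q) (ρ : CommLieRep 𝔽 g M)

/-- The restriction of a `g`-module to `h`. -/
def restrictRep : CommLieRep 𝔽 h M where
  act := ρ.act ∘ₗ e.incl
  act_bracket x y m := by simp [e.incl_bracket, ρ.act_bracket]

theorem bracket_mem_range (x : g) (y : h) :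
    lieBr 𝔽 x (e.incl y) ∈ LinearMap.range e.incl := by
  have : e.proj (lieBr 𝔽 x (e.incl y)) = 0 := by
    rw [e.proj_bracket, e.exact.apply_apply_eq_zero, map_zero]
  exact (e.exact _).1 this

/-- The adjoint action of `g` on the ideal `h`: `incl (adj x y) = [x, incl y]`. -/
noncomputable def adj : g →ₗ[𝔽] h →ₗ[𝔽] h :=
  LinearMap.mk₂ 𝔽
    (fun x y => (LinearEquiv.ofInjective e.incl e.incl_injective).symm
      ⟨lieBr 𝔽 x (e.incl y), bracket_mem_range e x y⟩)
    (fun x x' y => by rw [← map_add]; congr 1; ext; simp)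
    (fun c x y => by rw [← map_smul]; congr 1; ext; simp)
    (fun x y y' => by rw [← map_add]; congr 1; ext; simp)
    (fun c x y => by rw [← map_smul]; congr 1; ext; simp)

theorem incl_adj (x : g) (y : h) : e.incl (adj e x y) = lieBr 𝔽 x (e.incl y) := by
  have := LinearEquiv.apply_symm_apply (LinearEquiv.ofInjective e.incl e.incl_injective)
    ⟨lieBr 𝔽 x (e.incl y), bracket_mem_range e x y⟩
  exact congrArg Subtype.val this

theorem adj_incl (x : h) : adj e (e.incl x) = lieBr 𝔽 x := by
  ext y
  apply e.incl_injective
  rw [incl_adj, e.incl_bracket]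

variable [CharP 𝔽 2]

theorem isDerPair_adj (x : g) : IsDerPair (restrictRep e ρ) (ρ.act x) (adj e x) where
  der y z := by
    apply e.incl_injective
    simp only [incl_adj, e.incl_bracket, map_add]
    exact (isDerPair_lieDer ρ x).der _ _
  act y m := by
    have := (isDerPair_lieDer ρ x).act (e.incl y) m
    simp only [restrictRep, LinearMap.comp_apply, incl_adj]
    exact this

/-- The action of `g` on `HSⁿ(h, M)`, induced by
`(x · f)(y₁, …, yₙ) = x · f(y₁, …, yₙ) + ∑ᵢ f(y₁, …, [x, yᵢ], …, yₙ)` on cochains. -/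
noncomputable def actHS (n : ℕ) :
    g →ₗ[𝔽] HS (restrictRep e ρ) n →ₗ[𝔽] HS (restrictRep e ρ) n where
  toFun x := (HomologicalComplex.homologyMap (thetaHom (isDerPair_adj e ρ x)) n).hom
  map_add' x y := by
    rw [← ModuleCat.hom_add, ← HomologicalComplex.homologyMap_add]
    congr 2
    ext n f : 3
    refine ev_injective _ n ?_
    change theta (ρ.act (x + y)) (adj e (x + y)) n (ev _ n f) =
      theta (ρ.act x) (adj e x) n (ev _ n f) + theta (ρ.act y) (adj e y) n (ev _ n f)
    rw [map_add, map_add, theta_add]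
  map_smul' c x := by
    have : thetaHom (isDerPair_adj e ρ (c • x)) = c • thetaHom (isDerPair_adj e ρ x) := by
      ext n f : 3
      refine ev_injective _ n ?_
      change theta (ρ.act (c • x)) (adj e (c • x)) n (ev _ n f) =
        c • theta (ρ.act x) (adj e x) n (ev _ n f)
      rw [map_smul, map_smul, theta_smul]
    rw [this]
    exact congrArg ModuleCat.Hom.hom (ShortComplex.homologyMap_smul
      ((HomologicalComplex.shortComplexFunctor _ _ n).map (thetaHom (isDerPair_adj e ρ x))) c)

theorem actHS_incl (n : ℕ) (x : h) : actHS e ρ n (e.incl x) = 0 := by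
  have key : ∀ (D : h →ₗ[𝔽] h) (hD : D = lieBr 𝔽 x)
      (H : IsDerPair (restrictRep e ρ) ((restrictRep e ρ).act x) D),
      HomologicalComplex.homologyMap (thetaHom H) n = 0 := by
    rintro D rfl H
    exact homologyMap_lieDer _ x n H
  exact congrArg ModuleCat.Hom.hom (key _ (adj_incl e x) (isDerPair_adj e ρ (e.incl x)))

theorem actHS_bracket (n : ℕ) (x y : g) (a : HS (restrictRep e ρ) n) :
    actHS e ρ n (lieBr 𝔽 x y) a =
      actHS e ρ n x (actHS e ρ n y a) + actHS e ρ n y (actHS e ρ n x a) := by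
  have key : thetaHom (isDerPair_adj e ρ (lieBr 𝔽 x y)) =
      thetaHom (isDerPair_adj e ρ y) ≫ thetaHom (isDerPair_adj e ρ x) +
        thetaHom (isDerPair_adj e ρ x) ≫ thetaHom (isDerPair_adj e ρ y) := by
    ext n f : 3
    refine ev_injective _ n ?_
    change theta (ρ.act (lieBr 𝔽 x y)) (adj e (lieBr 𝔽 x y)) n (ev _ n f) =
      theta (ρ.act x) (adj e x) n (theta (ρ.act y) (adj e y) n (ev _ n f)) +
        theta (ρ.act y) (adj e y) n (theta (ρ.act x) (adj e x) n (ev _ n f))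
    rw [theta_comm]
    congr 2
    · ext m
      simp [ρ.act_bracket]
    · ext z
      apply e.incl_injective
      simp only [incl_adj, LinearMap.add_apply, LinearMap.comp_apply, map_add]
      have h1 := (isDerPair_lieDer ρ x).der y (e.incl z)
      have h2 := add_self (𝔽 := 𝔽) (lieBr 𝔽 y (lieBr 𝔽 x (e.incl z)))
      rw [h1]
      linear_combination (norm := module) -h2
  have h2 := congrArg (fun F => HomologicalComplex.homologyMap F n) key
  simp only [HomologicalComplex.homologyMap_add, HomologicalComplex.homologyMap_comp] at h2
  exact congrArg (fun F => F.hom a) h2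

/-- The `q`-module `HSⁿ(h, M)`: the class of `x ∈ g` in `q` acts as `x` does. -/
noncomputable def quotRep (n : ℕ) : CommLieRep 𝔽 q (HS (restrictRep e ρ) n) where
  act := (LinearMap.ker e.proj).liftQ (actHS e ρ n) (fun x hx => by
      obtain ⟨y, rfl⟩ := (e.exact x).1 hx
      exact actHS_incl e ρ n y) ∘ₗ
    (e.proj.quotKerEquivOfSurjective e.proj_surjective).symm.toLinearMap
  act_bracket x y a := by
    obtain ⟨x, rfl⟩ := e.proj_surjective x
    obtain ⟨y, rfl⟩ := e.proj_surjective y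
    have hs : ∀ z : g, (e.proj.quotKerEquivOfSurjective e.proj_surjective).symm (e.proj z) =
        (LinearMap.ker e.proj).mkQ z := fun z => by
      rw [LinearEquiv.symm_apply_eq]; rfl
    rw [← e.proj_bracket]
    simp only [LinearMap.comp_apply, LinearEquiv.coe_coe, hs,
      Submodule.mkQ_apply, Submodule.liftQ_apply]
    exact actHS_bracket e ρ n x y a

theorem quotRep_act_proj (n : ℕ) (x : g) : (quotRep e ρ n).act (e.proj x) = actHS e ρ n x := by
  have hs : (e.proj.quotKerEquivOfSurjective e.proj_surjective).symm (e.proj x) =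
      (LinearMap.ker e.proj).mkQ x := by
    rw [LinearEquiv.symm_apply_eq]; rfl
  simp only [quotRep, LinearMap.comp_apply, LinearEquiv.coe_coe, hs, Submodule.mkQ_apply,
    Submodule.liftQ_apply]

end Extension

/-! ### The spectral sequence of a filtered cochain complex -/

section Filtered

universe u w

variable {𝔽 : Type u} [Field 𝔽]

/-- `c` is a cocycle of degree `n` and `a` is its cohomology class. -/
def IsClassOf (K : CochainComplex (ModuleCat.{w} 𝔽) ℕ) (n : ℕ) (c : K.X n) (a : K.homology n) :
    Prop :=
  ∃ k : K.cycles n, K.iCycles n k = c ∧ K.homologyπ n k = a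

/-- A decreasing filtration of a cochain complex by subcomplexes. -/
structure Filtration (K : CochainComplex (ModuleCat.{w} 𝔽) ℕ) where
  F : ℤ → (n : ℕ) → Submodule 𝔽 (K.X n)
  anti : ∀ (p p' : ℤ) (n : ℕ), p ≤ p' → F p' n ≤ F p n
  d_mem : ∀ (p : ℤ) (n n' : ℕ) (c : K.X n), c ∈ F p n → K.d n n' c ∈ F p n'

namespace Filtration

variable {K : CochainComplex (ModuleCat.{w} 𝔽) ℕ} (Φ : Filtration K)

/-- `Z_r^p = {c ∈ Fᵖ | d c ∈ Fᵖ⁺ʳ}` in total degree `n`. -/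
def Z (r p : ℤ) (n : ℕ) : Submodule 𝔽 (K.X n) :=
  Φ.F p n ⊓ (Φ.F (p + r) (n + 1)).comap (K.d n (n + 1)).hom

/-- `Z_{r-1}^{p+1} + d Z_{r-1}^{p-r+1}` in total degree `n`. The components `K.d m n` of the
differential vanish unless `m + 1 = n`. -/
def B (r p : ℤ) (n : ℕ) : Submodule 𝔽 (K.X n) :=
  Φ.Z (r - 1) (p + 1) n ⊔ ⨆ m : ℕ, (Φ.Z (r - 1) (p - r + 1) m).map (K.d m n).hom

/-- `E_r^{p,n-p} = Z_r^p / (Z_{r-1}^{p+1} + d Z_{r-1}^{p-r+1})` in total degree `n`. -/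
abbrev E (r p : ℤ) (n : ℕ) : Type w :=
  Φ.Z r p n ⧸ (Φ.B r p n).submoduleOf (Φ.Z r p n)

/-- The class in `E_r` of an element of `Z_r^p`. -/
def toE (r p : ℤ) (n : ℕ) : Φ.Z r p n →ₗ[𝔽] Φ.E r p n :=
  ((Φ.B r p n).submoduleOf (Φ.Z r p n)).mkQ

theorem d_d_apply (n n' n'' : ℕ) (c : K.X n) : K.d n' n'' (K.d n n' c) = 0 := by
  rw [← ModuleCat.comp_apply, K.d_comp_d]; rfl

theorem d_mem_Z {r p p' : ℤ} (hp : p + r = p') (n n' : ℕ) (c : K.X n) (hc : c ∈ Φ.Z r p n) :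
    (K.d n n').hom c ∈ Φ.Z r p' n' := by
  subst hp
  by_cases h : n + 1 = n'
  · subst h
    refine ⟨hc.2, ?_⟩
    have : K.d (n + 1) (n + 1 + 1) (K.d n (n + 1) c) = 0 := d_d_apply ..
    exact Submodule.mem_comap.2 (this ▸ zero_mem _)
  · rw [K.shape n n' h]
    exact zero_mem _

theorem d_mem_B {r p p' : ℤ} (hp : p + r = p') (n n' : ℕ) (c : K.X n) (hc : c ∈ Φ.B r p n) :
    (K.d n n').hom c ∈ Φ.B r p' n' := by
  have hle : Φ.B r p n ≤ (Φ.B r p' n').comap (K.d n n').hom := by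
    refine sup_le (fun x hx => ?_) (iSup_le fun m => ?_)
    · refine Submodule.mem_sup_right (Submodule.mem_iSup_of_mem n ⟨x, ?_, rfl⟩)
      have : p' - r + 1 = p + 1 := by omega
      rw [this]
      exact hx
    · rintro _ ⟨x, -, rfl⟩
      have : K.d n n' (K.d m n x) = 0 := d_d_apply ..
      exact Submodule.mem_comap.2 (this ▸ zero_mem _)
  exact hle hc

/-- The differential of the `r`-th page, induced by the differential of the complex. -/
def dE {r p p' : ℤ} (hp : p + r = p') (n n' : ℕ) : Φ.E r p n →ₗ[𝔽] Φ.E r p' n' :=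
  Submodule.mapQ _ _ ((K.d n n').hom.restrict fun c hc => Φ.d_mem_Z hp n n' c hc)
    fun c hc => Φ.d_mem_B hp n n' c hc

open Classical in
/-- The `r`-th page of the spectral sequence of the filtration, in the first quadrant: its
differential is induced by `K.d` and has bidegree `(r, 1 - r)`. -/
noncomputable def page (r : ℤ) :
    HomologicalComplex (ModuleCat.{w} 𝔽) (ComplexShape.spectralSequenceNat (r, 1 - r)) where
  X pq := ModuleCat.of 𝔽 (Φ.E r pq.1 (pq.1 + pq.2))
  d pq pq' :=
    if h : (ComplexShape.spectralSequenceNat (r, 1 - r)).Rel pq pq' then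
      ModuleCat.ofHom (Φ.dE h.1 (pq.1 + pq.2) (pq'.1 + pq'.2))
    else 0
  shape pq pq' h := dif_neg h
  d_comp_d' i j k hij hjk := by
    rw [dif_pos hij, dif_pos hjk]
    refine ModuleCat.hom_ext (LinearMap.ext fun x => ?_)
    obtain ⟨z, rfl⟩ := Submodule.Quotient.mk_surjective _ x
    refine (Submodule.Quotient.mk_eq_zero _).2 ?_
    have : (K.d (j.1 + j.2) (k.1 + k.2)).hom ((K.d (i.1 + i.2) (j.1 + j.2)).hom z) = 0 :=
      d_d_apply ..
    refine Submodule.mem_comap.2 ?_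
    change (K.d (j.1 + j.2) (k.1 + k.2)).hom ((K.d (i.1 + i.2) (j.1 + j.2)).hom z) ∈
      Φ.B r k.1 (k.1 + k.2)
    rw [this]
    exact zero_mem _

/-- The class of `z ∈ Z_r^p` in position `(p, q)` of the `r`-th page. -/
noncomputable def toPage (r : ℤ) (pq : ℕ × ℕ) (z : Φ.Z r pq.1 (pq.1 + pq.2)) : (Φ.page r).X pq :=
  Φ.toE r pq.1 (pq.1 + pq.2) z

/-- The induced filtration of the cohomology: `Fᵖ Hⁿ` is the set of classes of cocycles in `Fᵖ`. -/
noncomputable def FH (p : ℤ) (n : ℕ) : Submodule 𝔽 (K.homology n) :=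
  ((Φ.F p n).comap (K.iCycles n).hom).map (K.homologyπ n).hom

/-- The graded piece `Fᵖ Hⁿ / Fᵖ⁺¹ Hⁿ`. -/
abbrev grH (p : ℤ) (n : ℕ) : Type w :=
  Φ.FH p n ⧸ (Φ.FH (p + 1) n).submoduleOf (Φ.FH p n)

end Filtration

end Filtered

/-! ### The filtration by the number of arguments in `h` -/

section HochschildSerre

universe u vh vg vq w

variable {𝔽 : Type u} {h : Type vh} {g : Type vg} {q : Type vq} {M : Type w} [Field 𝔽]
  [AddCommGroup h] [Module 𝔽 h] [CommLieAlgebra 𝔽 h]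
  [AddCommGroup g] [Module 𝔽 g] [CommLieAlgebra 𝔽 g]
  [AddCommGroup q] [Module 𝔽 q] [CommLieAlgebra 𝔽 q]
  [AddCommGroup M] [Module 𝔽 M]
  (e : CommLieExtension 𝔽 h g q) (ρ : CommLieRep 𝔽 g M)

/-- `f(x₁, …, xₙ) = 0` as soon as (at least) `n - p + 1` of the arguments `xᵢ` belong to `h`. -/
def VanishesOn (p : ℤ) (n : ℕ) (f : ML 𝔽 g M n) : Prop :=
  ∀ (x : Fin n → g) (S : Finset (Fin n)), (n : ℤ) - p + 1 ≤ S.card →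
    (∀ i ∈ S, x i ∈ LinearMap.range e.incl) → f x = 0

theorem VanishesOn.ce {p : ℤ} {n : ℕ} {f : ML 𝔽 g M n} (hf : VanishesOn e p n f) :
    VanishesOn e p (n + 1) (ce ρ n f) := by
  intro x S hS hx
  rw [ce_apply]
  -- at least `n - p + 1` arguments other than the `i`-th one lie in `h`
  have hcard : ∀ i : Fin (n + 1), (n : ℤ) - p + 1 ≤
      (Finset.univ.filter fun k : Fin n => i.succAbove k ∈ S).card := by
    intro i
    have h1 : S ⊆ insert i ((Finset.univ.filter fun k : Fin n => i.succAbove k ∈ S).map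
        i.succAboveEmb) := by
      intro k hk
      by_cases hki : k = i
      · simp [hki]
      · obtain ⟨k', rfl⟩ := Fin.exists_succAbove_eq hki
        simp [hk]
    have h2 := (Finset.card_le_card h1).trans (Finset.card_insert_le _ _)
    rw [Finset.card_map] at h2
    push_cast at hS
    omega
  have h1 : ∀ i : Fin (n + 1), f (i.removeNth x) = 0 := fun i =>
    hf _ _ (hcard i) fun k hk => hx _ (Finset.mem_filter.1 hk).2
  have h2 : ∀ (i : Fin (n + 1)) (j : Fin n),
      f (Function.update (i.removeNth x) j (lieBr 𝔽 (x i) (x (i.succAbove j)))) = 0 := by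
    intro i j
    refine hf _ _ (hcard i) fun k hk => ?_
    have hk' := hx _ (Finset.mem_filter.1 hk).2
    by_cases hkj : k = j
    · subst hkj
      obtain ⟨y, hy⟩ := hk'
      rw [Function.update_self, ← hy]
      exact bracket_mem_range e _ y
    · rw [Function.update_of_ne hkj]
      exact hk'
  simp [ceSum, h1, h2]

variable [CharP 𝔽 2]

/-- The filtration `Fᵖ CSⁿ(g, M)` of the cochains by the number of arguments in `h`. -/
noncomputable def hsFiltration : Filtration (csComplex ρ) where
  F p n :=
    { carrier := {f | VanishesOn e p n (ev ρ n f)}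
      add_mem' := fun hf hf' x S hS hx => by
        rw [map_add, add_apply, hf x S hS hx, hf' x S hS hx, add_zero]
      zero_mem' := fun x S hS hx => by rw [map_zero]; rfl
      smul_mem' := fun c f hf x S hS hx => by
        rw [map_smul, smul_apply, hf x S hS hx, smul_zero] }
  anti p p' n hpp' f hf x S hS hx := hf x S (by omega) hx
  d_mem p n n' f hf := by
    by_cases hn : n + 1 = n'
    · subst hn
      change VanishesOn e p (n + 1) (ev ρ (n + 1) _)
      rw [ev_d]
      exact VanishesOn.ce e ρ hf
    · rw [(csComplex ρ).shape n n' hn]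
      exact zero_mem _

/-- For `f ∈ CSᵖ⁺ᵠ(g, M)` and a cochain `φ ∈ CSᵖ(q, HSᵠ(h, M))`: for all `x₁, …, xₚ ∈ g`, the map
`(y₁, …, y_q) ↦ f(x₁, …, xₚ, y₁, …, y_q)` on `h` is a cocycle in `CSᵠ(h, M)`, and `φ` sends the
images of `x₁, …, xₚ` in `q` to its class. -/
def IsInducedCochain (p n : ℕ) (f : (csComplex ρ).X (p + n))
    (φ : (csComplex (quotRep e ρ n)).X p) : Prop :=
  ∀ x : Fin p → g, ∃ c : (csComplex (restrictRep e ρ)).X n,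
    (∀ y : Fin n → h, ev _ n c y = ev ρ (p + n) f (Fin.append x (e.incl ∘ y))) ∧
    IsClassOf (csComplex (restrictRep e ρ)) n c (ev _ p φ (e.proj ∘ x))

end HochschildSerre

end CommLie

universe u vh vg vq w

/-! The proof separates a formal part about filtered complexes from the computation of the second
page.

Formal part: the filtration satisfies `Fᵖ Kⁿ = Kⁿ` for `p ≤ 0` and `Fᵖ Kⁿ = 0` for `p > n`. For any
such filtration, a cycle of `E_r` has a representative in `Z_{r+1}`, and an element of `Z_{r+1}`
represents a boundary of `E_r` exactly when it lies in `B_{r+1}`; this is `H(E_r) ≅ E_{r+1}`. Once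
`r > max(p, q + 1)`, elements of `Z_r` are cocycles and every primitive is admissible in `B_r`, so
`E_r` is the graded piece of the cohomology.

Second page: for `f` of degree `p + n`, let `splitRes f` be the map on `gᵖ` with values in the
`n`-cochains of `h` obtained by restricting the last `n` arguments to `h`. By symmetry, `f ∈ Fᵖ⁺¹`
iff `splitRes f = 0` (`vanishesOn_succ_iff`), and for `f ∈ Fᵖ` the map `splitRes f` depends only on
images in `q`. Cartan's formula yields by induction that the split form of `df` is the sum of a
differential over `g` with coefficients in cochains of `h` and the differential of `h` applied to
values (`splitRes_succ_succ_ce`). Hence `d₀` is the differential of `h`, and on cohomology classes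
`d₁` is the differential of `q` with coefficients in `HSⁿ(h, M)` (`inducedML_ce`).

So each `f ∈ Z₁` induces a cochain on `q` with values in `HSⁿ(h, M)`. Every such cochain arises:
cocycle representatives are chosen linearly, which is possible over a field, and extended to `g` by
a sum over shuffles, which needs no division and so works in characteristic `2`
(`exists_inducedML_eq`). If `f` induces zero, linearly chosen primitives extended in the same way
give `f ∈ Fᵖ⁺¹ + dFᵖ` (`exists_sub_d_mem`). These two facts make `Z₂ → HSᵖ(q, HSⁿ(h, M))` surjective
with kernel `Z₂ ∩ B₂`. -/

namespace CommLie

/-! ### Cocycles, cohomology classes and quotients -/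

section Homology

variable {R : Type*} [Ring R] {ι : Type*} {c : ComplexShape ι}
  (K : HomologicalComplex (ModuleCat R) c)

theorem exists_iCycles_eq {i : ι} (j : ι) (hj : c.next i = j) (x : K.X i) (hx : K.d i j x = 0) :
    ∃ k : K.cycles i, K.iCycles i k = x := by
  subst hj
  refine ⟨(K.sc i).moduleCatCyclesIso.inv ⟨x, hx⟩, ?_⟩
  have h := (K.sc i).moduleCatCyclesIso_inv_iCycles
  exact congrArg (fun F => F.hom ⟨x, hx⟩) h

theorem d_iCycles_apply (i j : ι) (k : K.cycles i) : K.d i j (K.iCycles i k) = 0 := by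
  rw [← ModuleCat.comp_apply, HomologicalComplex.iCycles_d]; rfl

theorem iCycles_injective (i : ι) : Function.Injective (K.iCycles i) :=
  (ModuleCat.mono_iff_injective _).1 inferInstance

theorem homologyπ_surjective (i : ι) : Function.Surjective (K.homologyπ i) :=
  (ModuleCat.epi_iff_surjective _).1 inferInstance

/-- The source degree `i` is left free, since components of `d` between unrelated degrees vanish;
this treats degree `0` of a cochain complex uniformly. -/
theorem homologyπ_eq_zero_iff {j : ι} (k : K.cycles j) :
    K.homologyπ j k = 0 ↔ ∃ (i : ι) (x : K.X i), K.d i j x = K.iCycles j k := by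
  constructor
  · intro h
    have hex : (ShortComplex.mk (K.toCycles (c.prev j) j) (K.homologyπ j) (by simp)).Exact :=
      ShortComplex.exact_of_g_is_cokernel _ (K.homologyIsCokernel _ j rfl)
    obtain ⟨x, hx⟩ := (ShortComplex.moduleCat_exact_iff _).1 hex k h
    refine ⟨_, x, ?_⟩
    rw [← K.toCycles_i (c.prev j) j, ModuleCat.comp_apply]
    exact congrArg _ hx
  · rintro ⟨i, x, hx⟩
    have : K.toCycles i j x = k := by
      apply iCycles_injective
      rw [← ModuleCat.comp_apply, K.toCycles_i, hx]
    rw [← this, ← ModuleCat.comp_apply, K.toCycles_comp_homologyπ]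
    rfl

/-- A linear map into the cocycles of `K` lifts to `K.cycles`. -/
theorem exists_lift_cycles {V : Type*} [AddCommGroup V] [Module R V] {i : ι}
    (f : V →ₗ[R] K.X i) (hf : ∀ v j, K.d i j (f v) = 0) :
    ∃ f' : V →ₗ[R] K.cycles i, ∀ v, K.iCycles i (f' v) = f v := by
  refine ⟨(K.sc i).moduleCatCyclesIso.inv.hom ∘ₗ f.codRestrict (LinearMap.ker (K.sc i).g.hom)
    fun v => hf v _, fun v => ?_⟩
  have h := (K.sc i).moduleCatCyclesIso_inv_iCycles
  exact congrArg (fun F => F.hom ⟨f v, hf v _⟩) h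

end Homology

section Classes

variable {𝔽 : Type u} [Field 𝔽] {K : CochainComplex (ModuleCat.{w} 𝔽) ℕ}

theorem IsClassOf.d_eq_zero {n : ℕ} {c : K.X n} {a : K.homology n} (h : IsClassOf K n c a)
    (m : ℕ) : K.d n m c = 0 := by
  obtain ⟨k, rfl, -⟩ := h
  exact d_iCycles_apply K n m k

theorem exists_isClassOf {n : ℕ} {c : K.X n} (h : K.d n (n + 1) c = 0) :
    ∃ a, IsClassOf K n c a := by
  obtain ⟨k, hk⟩ := exists_iCycles_eq K (n + 1) (by simp) c h
  exact ⟨_, k, hk, rfl⟩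

theorem isClassOf_surjective {n : ℕ} (a : K.homology n) : ∃ c, IsClassOf K n c a := by
  obtain ⟨k, hk⟩ := homologyπ_surjective K n a
  exact ⟨_, k, rfl, hk⟩

theorem IsClassOf.sub {n : ℕ} {c c' : K.X n} {a a' : K.homology n} (h : IsClassOf K n c a)
    (h' : IsClassOf K n c' a') : IsClassOf K n (c - c') (a - a') := by
  obtain ⟨k, rfl, rfl⟩ := h
  obtain ⟨k', rfl, rfl⟩ := h'
  exact ⟨k - k', by simp, by simp⟩

theorem IsClassOf.eq_zero_iff {n : ℕ} {c : K.X n} {a : K.homology n} (h : IsClassOf K n c a) :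
    a = 0 ↔ ∃ (m : ℕ) (b : K.X m), K.d m n b = c := by
  obtain ⟨k, rfl, rfl⟩ := h
  exact homologyπ_eq_zero_iff K k

theorem IsClassOf.unique {n : ℕ} {c : K.X n} {a a' : K.homology n} (h : IsClassOf K n c a)
    (h' : IsClassOf K n c a') : a = a' := by
  obtain ⟨k, rfl, rfl⟩ := h
  obtain ⟨k', hk, rfl⟩ := h'
  rw [iCycles_injective K n hk]

end Classes

section Quotient

variable {R V W : Type*} [Ring R] [AddCommGroup V] [Module R V] [AddCommGroup W] [Module R W]

/-- A surjection `Z → W` with kernel `Z ∩ B` identifies `Z / (Z ∩ B)` with `W`. -/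
noncomputable def quotEquiv (Z B : Submodule R V) (ψ : Z →ₗ[R] W) (hψ : Function.Surjective ψ)
    (hker : ∀ z, ψ z = 0 ↔ (z : V) ∈ B) : (Z ⧸ B.submoduleOf Z) ≃ₗ[R] W :=
  (Submodule.quotEquivOfEq _ _ (by
    ext z
    rw [LinearMap.mem_ker, hker]
    rfl)).trans (ψ.quotKerEquivOfSurjective hψ)

theorem quotEquiv_mk (Z B : Submodule R V) (ψ : Z →ₗ[R] W) (hψ : Function.Surjective ψ)
    (hker : ∀ z, ψ z = 0 ↔ (z : V) ∈ B) (z : Z) :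
    quotEquiv Z B ψ hψ hker (Submodule.Quotient.mk z) = ψ z := rfl

end Quotient

/-! ### The spectral sequence of a first quadrant filtration -/

namespace Filtration

variable {𝔽 : Type u} [Field 𝔽] {K : CochainComplex (ModuleCat.{w} 𝔽) ℕ} (Φ : Filtration K)

theorem mem_Z {r p : ℤ} {n : ℕ} {c : K.X n} :
    c ∈ Φ.Z r p n ↔ c ∈ Φ.F p n ∧ K.d n (n + 1) c ∈ Φ.F (p + r) (n + 1) := Iff.rfl

/-- At most one component of `d` into degree `n` is nonzero, so the supremum over `m` reduces to a
single image. In degree `0` it is zero, and `b = 0` serves. -/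
theorem mem_B {r p : ℤ} {n : ℕ} {c : K.X n} :
    c ∈ Φ.B r p n ↔ ∃ a ∈ Φ.Z (r - 1) (p + 1) n, ∃ (m : ℕ), ∃ b ∈ Φ.Z (r - 1) (p - r + 1) m,
      c = a + K.d m n b := by
  constructor
  · intro h
    obtain ⟨a, ha, y, hy, rfl⟩ := Submodule.mem_sup.1 h
    refine ⟨a, ha, ?_⟩
    cases n with
    | zero =>
      refine ⟨0, 0, zero_mem _, ?_⟩
      have : y ∈ (⊥ : Submodule 𝔽 (K.X 0)) := by
        refine (iSup_le fun m => ?_ : _ ≤ (⊥ : Submodule 𝔽 (K.X 0))) hy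
        rintro _ ⟨x, -, rfl⟩
        rw [K.shape m 0 (by simp)]
        rfl
      rw [(Submodule.mem_bot _).1 this, map_zero]
    | succ n =>
      refine ⟨n, ?_⟩
      have : y ∈ (Φ.Z (r - 1) (p - r + 1) n).map (K.d n (n + 1)).hom := by
        refine (iSup_le fun m => ?_ : _ ≤ (Φ.Z (r - 1) (p - r + 1) n).map (K.d n (n + 1)).hom) hy
        by_cases hm : m = n
        · rw [hm]
        · rintro _ ⟨x, -, rfl⟩
          rw [K.shape m (n + 1) (by simpa using hm)]
          exact zero_mem _
      obtain ⟨b, hb, rfl⟩ := this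
      exact ⟨b, hb, rfl⟩
  · rintro ⟨a, ha, m, b, hb, rfl⟩
    exact add_mem (Submodule.mem_sup_left ha)
      (Submodule.mem_sup_right (Submodule.mem_iSup_of_mem m ⟨b, hb, rfl⟩))

theorem Z_mono {r r' p p' : ℤ} (hp : p' ≤ p) (hr : p' + r' ≤ p + r) (n : ℕ) :
    Φ.Z r p n ≤ Φ.Z r' p' n :=
  fun _ hc => ⟨Φ.anti _ _ _ hp hc.1, Φ.anti _ _ _ hr hc.2⟩

theorem toPage_surjective (r : ℤ) (pq : ℕ × ℕ) : Function.Surjective (Φ.toPage r pq) :=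
  Submodule.Quotient.mk_surjective _

theorem toPage_eq_zero_iff (r : ℤ) (pq : ℕ × ℕ) (z : Φ.Z r pq.1 (pq.1 + pq.2)) :
    Φ.toPage r pq z = 0 ↔ (z : K.X (pq.1 + pq.2)) ∈ Φ.B r pq.1 (pq.1 + pq.2) :=
  Submodule.Quotient.mk_eq_zero _

theorem toPage_eq_iff (r : ℤ) (pq : ℕ × ℕ) (z z' : Φ.Z r pq.1 (pq.1 + pq.2)) :
    Φ.toPage r pq z = Φ.toPage r pq z' ↔
      (z - z' : K.X (pq.1 + pq.2)) ∈ Φ.B r pq.1 (pq.1 + pq.2) :=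
  Submodule.Quotient.eq _

theorem page_d_toPage (r : ℤ) {pq pq' : ℕ × ℕ}
    (h : (ComplexShape.spectralSequenceNat (r, 1 - r)).Rel pq pq')
    (z : Φ.Z r pq.1 (pq.1 + pq.2)) :
    (Φ.page r).d pq pq' (Φ.toPage r pq z) = Φ.toPage r pq'
      ⟨K.d (pq.1 + pq.2) (pq'.1 + pq'.2) z, Φ.d_mem_Z h.1 _ _ _ z.2⟩ := by
  have : (Φ.page r).d pq pq' = ModuleCat.ofHom (Φ.dE h.1 (pq.1 + pq.2) (pq'.1 + pq'.2)) :=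
    dif_pos h
  rw [this]
  rfl

/-- A filtration of first quadrant type: `Fᵖ Kⁿ` is everything for `p ≤ 0` and zero for `p > n`. -/
structure IsFirstQuadrant : Prop where
  eq_top : ∀ (p : ℤ) (n : ℕ), p ≤ 0 → Φ.F p n = ⊤
  eq_bot : ∀ (p : ℤ) (n : ℕ), (n : ℤ) < p → Φ.F p n = ⊥

theorem d_mem_F {r p p' : ℤ} {n n' : ℕ} (hn : n + 1 = n') (hp : p + r = p') {c : K.X n}
    (hc : c ∈ Φ.Z r p n) : K.d n n' c ∈ Φ.F p' n' := by
  subst hn hp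
  exact hc.2

/-- One extra step of filtration puts `dz`, which is a cocycle, in the summand `Z_{r-1}^{p+r+1}` of
the denominator at the target. -/
theorem page_d_eq_zero {r : ℤ} {pq : ℕ × ℕ} (z : Φ.Z r pq.1 (pq.1 + pq.2))
    (hz : (z : K.X (pq.1 + pq.2)) ∈ Φ.Z (r + 1) pq.1 (pq.1 + pq.2))
    (pq' : ℕ × ℕ) : (Φ.page r).d pq pq' (Φ.toPage r pq z) = 0 := by
  by_cases h : (ComplexShape.spectralSequenceNat (r, 1 - r)).Rel pq pq'
  · rw [page_d_toPage Φ r h, toPage_eq_zero_iff, mem_B]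
    have h1 : (pq.1 : ℤ) + (r + 1) = pq'.1 + 1 := by have := h.1; simp only at this; omega
    have h3 : pq'.1 + pq'.2 = pq.1 + pq.2 + 1 := by
      have := h.1; have := h.2; simp only at *; omega
    refine ⟨_, Φ.mem_Z.2 ⟨Φ.d_mem_F h3.symm h1 hz, ?_⟩, 0, 0, zero_mem _, by rw [map_zero, add_zero]⟩
    rw [d_d_apply]
    exact zero_mem _
  · rw [(Φ.page r).shape _ _ h]
    rfl

/-- Cycles of `E_r` come from `Z_{r+1}`: write `dz = a + db` with `a ∈ Z_{r-1}^{p+r+1}` and `b ∈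
Z_{r-1}^{p+1}`. Then `b` lies in the denominator at `p`, and `d(z - b) = a` has gained one step of
filtration. -/
theorem exists_sub_mem_Z {r p : ℤ} {n n' : ℕ} (hn : n + 1 = n') {z : K.X n} (hz : z ∈ Φ.Z r p n)
    (hd : K.d n n' z ∈ Φ.B r (p + r) n') : ∃ y ∈ Φ.B r p n, z - y ∈ Φ.Z (r + 1) p n := by
  subst hn
  obtain ⟨a, ha, m, b, hb, hab⟩ := Φ.mem_B.1 hd
  rw [add_sub_cancel_right] at hb
  obtain ⟨b', hb', hab'⟩ : ∃ b' ∈ Φ.Z (r - 1) (p + 1) n, K.d n (n + 1) b' = K.d m (n + 1) b := by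
    by_cases hm : m = n
    · subst hm
      exact ⟨b, hb, rfl⟩
    · refine ⟨0, zero_mem _, ?_⟩
      rw [K.shape m (n + 1) (by simpa using hm), map_zero]
      rfl
  refine ⟨b', Φ.mem_B.2 ⟨b', hb', 0, 0, zero_mem _, by simp⟩, Φ.mem_Z.2 ⟨?_, ?_⟩⟩
  · exact sub_mem hz.1 (Φ.anti _ _ _ (by omega) hb'.1)
  · rw [map_sub, hab, hab', add_sub_cancel_right]
    exact Φ.anti _ _ _ (by omega) ha.1

/-- Boundaries of `E_r` that are represented in `Z_{r+1}` lie in `B_{r+1}`. The image part of `B_r`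
and `dy` are already in `B_{r+1}`; the remaining error `a ∈ Z_{r-1}^{p+1}` has to be improved to
`Z_r^{p+1}`. -/
theorem mem_B_succ {r p : ℤ} {m n : ℕ} {z : K.X n} (hz : z ∈ Φ.Z (r + 1) p n) {y : K.X m}
    (hy : y ∈ Φ.Z r (p - r) m) (hzy : K.d m n y - z ∈ Φ.B r p n) : z ∈ Φ.B (r + 1) p n := by
  have hsub : Φ.B r p n ≤ Φ.Z (r - 1) (p + 1) n ⊔ Φ.B (r + 1) p n := by
    intro c hc
    obtain ⟨a, ha, k, b, hb, rfl⟩ := Φ.mem_B.1 hc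
    refine add_mem (Submodule.mem_sup_left ha) (Submodule.mem_sup_right (Φ.mem_B.2
      ⟨0, zero_mem _, k, b, Φ.Z_mono (by omega) (by omega) _ hb, by simp⟩))
  have hdy : K.d m n y ∈ Φ.B (r + 1) p n := Φ.mem_B.2
    ⟨0, zero_mem _, m, y, Φ.Z_mono (by omega) (by omega) _ hy, by simp⟩
  obtain ⟨a, ha, b, hb, hab⟩ := Submodule.mem_sup.1 (hsub hzy)
  have hz' : z = -a + (K.d m n y - b) := by rw [neg_add_eq_sub, sub_sub, add_comm b, hab]; abel
  have hbd : K.d n (n + 1) b ∈ Φ.F (p + (r + 1)) (n + 1) := by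
    obtain ⟨a', ha', k, b', -, rfl⟩ := Φ.mem_B.1 hb
    rw [map_add, d_d_apply, add_zero]
    exact Φ.anti _ _ _ (by omega) ha'.2
  -- `a` differs from `-z - b` by the cocycle `dy`, so `da` inherits the better level `p + r + 1`
  -- from `dz` and `db`.
  have ha2 : K.d n (n + 1) a ∈ Φ.F (p + (r + 1)) (n + 1) := by
    have h1 : K.d n (n + 1) a = K.d n (n + 1) (K.d m n y - z) - K.d n (n + 1) b := by
      rw [← hab, map_add, add_sub_cancel_right]
    rw [h1, map_sub, d_d_apply, zero_sub]
    exact sub_mem (neg_mem hz.2) hbd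
  rw [hz']
  refine add_mem (neg_mem (Φ.mem_B.2 ⟨a, ⟨ha.1, ?_⟩, 0, 0, zero_mem _, by simp⟩)) (sub_mem hdy hb)
  exact Submodule.mem_comap.2 (Φ.anti _ _ _ (by omega) ha2)

variable {Φ}

theorem IsFirstQuadrant.exists_toPage_eq_of_cycle (hΦ : Φ.IsFirstQuadrant) {r : ℤ} (hr : 0 ≤ r)
    {pq : ℕ × ℕ} (x : (Φ.page r).X pq) (hx : ∀ pq', (Φ.page r).d pq pq' x = 0) :
    ∃ z : Φ.Z r pq.1 (pq.1 + pq.2),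
      (z : K.X (pq.1 + pq.2)) ∈ Φ.Z (r + 1) pq.1 (pq.1 + pq.2) ∧ Φ.toPage r pq z = x := by
  obtain ⟨z, rfl⟩ := Φ.toPage_surjective r pq x
  by_cases h : r ≤ pq.2 + 1
  · lift r to ℕ using hr
    have hrel : (ComplexShape.spectralSequenceNat ((r : ℤ), 1 - (r : ℤ))).Rel pq
        (pq.1 + r, pq.2 + 1 - r) := by
      constructor <;> simp only <;> omega
    have h1 := hx (pq.1 + r, pq.2 + 1 - r)
    rw [page_d_toPage Φ r hrel, toPage_eq_zero_iff] at h1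
    obtain ⟨y, hy, hzy⟩ := Φ.exists_sub_mem_Z (n' := pq.1 + r + (pq.2 + 1 - r)) (by omega) z.2
      (by push_cast at h1; exact h1)
    refine ⟨⟨z - y, Φ.Z_mono le_rfl (by omega) _ hzy⟩, hzy, ?_⟩
    rw [toPage_eq_iff]
    simpa using hy
  -- The target would have a negative row, so the page imposes no condition; but then `p + r > p + q
  -- + 1` and `dz ∈ Fᵖ⁺ʳ Kᵖ⁺ᵠ⁺¹ = 0`.
  · refine ⟨z, Φ.mem_Z.2 ⟨z.2.1, ?_⟩, rfl⟩
    have h1 := Φ.d_mem_F rfl rfl z.2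
    rw [hΦ.eq_bot _ _ (by push_cast; omega), Submodule.mem_bot] at h1
    rw [h1]
    exact zero_mem _

theorem IsFirstQuadrant.exists_d_eq_toPage_iff (hΦ : Φ.IsFirstQuadrant) {r : ℤ} (hr : 0 ≤ r)
    {pq : ℕ × ℕ} (z : Φ.Z r pq.1 (pq.1 + pq.2))
    (hz : (z : K.X (pq.1 + pq.2)) ∈ Φ.Z (r + 1) pq.1 (pq.1 + pq.2)) :
    (∃ (i : ℕ × ℕ) (x : (Φ.page r).X i), (Φ.page r).d i pq x = Φ.toPage r pq z) ↔
      (z : K.X (pq.1 + pq.2)) ∈ Φ.B (r + 1) pq.1 (pq.1 + pq.2) := by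
  constructor
  · rintro ⟨i, x, hx⟩
    obtain ⟨y, rfl⟩ := Φ.toPage_surjective r i x
    by_cases h : (ComplexShape.spectralSequenceNat (r, 1 - r)).Rel i pq
    · rw [page_d_toPage Φ r h, toPage_eq_iff] at hx
      have h1 : (pq.1 : ℤ) - r = i.1 := by have := h.1; simp only at this; omega
      refine Φ.mem_B_succ hz (y := (y : K.X (i.1 + i.2))) ?_ hx
      rw [h1]
      exact y.2
    · rw [(Φ.page r).shape _ _ h] at hx
      have h1 := (Φ.toPage_eq_zero_iff r pq z).1 hx.symm
      exact Φ.mem_B_succ hz (zero_mem (Φ.Z r (pq.1 - r) 0))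
        (by rw [map_zero, zero_sub]; exact neg_mem h1)
  · intro h
    obtain ⟨a, ha, m, b, hb, hab⟩ := Φ.mem_B.1 h
    rw [add_sub_cancel_right] at ha hb
    have ha' : a ∈ Φ.Z (r - 1) (pq.1 + 1) (pq.1 + pq.2) := Φ.Z_mono le_rfl (by omega) _ ha
    -- If `db` is already in `B_r`, the class of `z` is zero and is hit by `0`. This disposes of
    -- every source position outside the quadrant.
    have key : K.d m (pq.1 + pq.2) b ∈ Φ.B r pq.1 (pq.1 + pq.2) →
        ∃ (i : ℕ × ℕ) (x : (Φ.page r).X i), (Φ.page r).d i pq x = Φ.toPage r pq z := by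
      intro hB
      refine ⟨pq, 0, ?_⟩
      rw [map_zero]
      refine ((Φ.toPage_eq_zero_iff r pq z).2 ?_).symm
      rw [hab]
      exact add_mem (Φ.mem_B.2 ⟨a, ha', 0, 0, zero_mem _, by simp⟩) hB
    by_cases hm : m + 1 = pq.1 + pq.2
    -- A negative source column `p - r`: here `F^{p-r+1}` is the whole complex, so `b` belongs to
    -- `Z_{r-1}^{p-r+1}`.
    · by_cases hp : (pq.1 : ℤ) < r
      · refine key (Φ.mem_B.2 ⟨0, zero_mem _, m, b, Φ.mem_Z.2 ⟨?_, ?_⟩, by simp⟩)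
        · rw [hΦ.eq_top _ _ (by omega)]
          trivial
        · exact Φ.anti _ _ _ (by omega) (Φ.d_mem_F rfl rfl hb)
      -- A negative source row `q + r - 1` occurs only for `q = r = 0`, and then `b ∈ Fᵖ Kᵖ⁻¹ = 0`.
      · by_cases hq : (pq.2 : ℤ) + r < 1
        · have h1 : b ∈ Φ.F _ m := hb.1
          rw [hΦ.eq_bot _ _ (by omega), Submodule.mem_bot] at h1
          refine key ?_
          rw [h1, map_zero]
          exact zero_mem _
        · lift r to ℕ using hr
          obtain ⟨i, hi1, hi2⟩ : ∃ i : ℕ × ℕ, i.1 = pq.1 - r ∧ i.2 = pq.2 + r - 1 :=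
            ⟨(_, _), rfl, rfl⟩
          obtain rfl : m = i.1 + i.2 := by omega
          have hrel : (ComplexShape.spectralSequenceNat ((r : ℤ), 1 - (r : ℤ))).Rel i pq := by
            constructor <;> simp only <;> omega
          have h1 : (pq.1 : ℤ) - r = i.1 := by omega
          refine ⟨i, Φ.toPage r i ⟨b, Φ.Z_mono (by omega) (by omega) _ hb⟩, ?_⟩
          rw [page_d_toPage Φ r hrel, toPage_eq_iff, hab]
          refine Φ.mem_B.2 ⟨-a, neg_mem ha', 0, 0, zero_mem _, ?_⟩
          rw [map_zero]
          abel
    · refine key ?_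
      rw [K.shape _ _ hm]
      exact zero_mem _

/-- `H(E_r) ≅ E_{r+1}`, the identity on representatives. -/
theorem IsFirstQuadrant.exists_homology_iso (hΦ : Φ.IsFirstQuadrant) {r : ℤ} (hr : 0 ≤ r)
    (pq : ℕ × ℕ) : ∃ ε : (Φ.page r).homology pq ≃ₗ[𝔽] (Φ.page (r + 1)).X pq,
      ∀ (z : K.X (pq.1 + pq.2)) (hz : z ∈ Φ.Z r pq.1 (pq.1 + pq.2))
        (hz' : z ∈ Φ.Z (r + 1) pq.1 (pq.1 + pq.2)) (k : (Φ.page r).cycles pq),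
        (Φ.page r).iCycles pq k = Φ.toPage r pq ⟨z, hz⟩ →
          ε ((Φ.page r).homologyπ pq k) = Φ.toPage (r + 1) pq ⟨z, hz'⟩ := by
  have hle : Φ.Z (r + 1) pq.1 (pq.1 + pq.2) ≤ Φ.Z r pq.1 (pq.1 + pq.2) :=
    Φ.Z_mono le_rfl (by omega) _
  -- The isomorphism is built backwards, from the map `Z_{r+1} → H(E_r)` sending an element to the
  -- class of the cycle it represents; it is onto with kernel `Z_{r+1} ∩ B_{r+1}`.
  obtain ⟨ψ, hψ⟩ := exists_lift_cycles (Φ.page r)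
    (Φ.toE r pq.1 (pq.1 + pq.2) ∘ₗ Submodule.inclusion hle)
    (fun z pq' => Φ.page_d_eq_zero (Submodule.inclusion hle z) z.2 pq')
  have hsurj : Function.Surjective (((Φ.page r).homologyπ pq).hom ∘ₗ ψ) := by
    refine (homologyπ_surjective _ _).comp fun k => ?_
    obtain ⟨z, hz, hzk⟩ := hΦ.exists_toPage_eq_of_cycle hr ((Φ.page r).iCycles pq k)
      fun pq' => d_iCycles_apply _ _ _ _
    exact ⟨⟨z, hz⟩, iCycles_injective _ _ ((hψ _).trans hzk)⟩
  have hker : ∀ z : Φ.Z (r + 1) pq.1 (pq.1 + pq.2),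
      (((Φ.page r).homologyπ pq).hom ∘ₗ ψ) z = 0 ↔
        (z : K.X (pq.1 + pq.2)) ∈ Φ.B (r + 1) pq.1 (pq.1 + pq.2) := fun z => by
    rw [← hΦ.exists_d_eq_toPage_iff hr ⟨z, hle z.2⟩ z.2]
    refine (homologyπ_eq_zero_iff _ _).trans ?_
    rw [hψ]
    rfl
  refine ⟨(quotEquiv _ _ _ hsurj hker).symm, fun z hz hz' k hk => ?_⟩
  refine (LinearEquiv.symm_apply_eq (quotEquiv _ _ _ hsurj hker)).2 ?_
  refine Eq.trans ?_ (quotEquiv_mk _ _ _ hsurj hker ⟨z, hz'⟩).symm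
  have : k = ψ ⟨z, hz'⟩ := iCycles_injective _ _ (hk.trans (Eq.symm (hψ ⟨z, hz'⟩)))
  rw [this]
  rfl

theorem mem_FH {p : ℤ} {n : ℕ} {a : K.homology n} :
    a ∈ Φ.FH p n ↔ ∃ c ∈ Φ.F p n, IsClassOf K n c a := by
  constructor
  · rintro ⟨k, hk, rfl⟩
    exact ⟨_, hk, k, rfl, rfl⟩
  · rintro ⟨c, hc, k, rfl, rfl⟩
    exact ⟨k, hc, rfl⟩

theorem IsFirstQuadrant.FH_zero (hΦ : Φ.IsFirstQuadrant) (n : ℕ) : Φ.FH 0 n = ⊤ := by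
  refine eq_top_iff.2 fun a _ => mem_FH.2 ?_
  obtain ⟨c, hc⟩ := isClassOf_surjective a
  exact ⟨c, by rw [hΦ.eq_top _ _ le_rfl]; trivial, hc⟩

theorem IsFirstQuadrant.FH_succ (hΦ : Φ.IsFirstQuadrant) (n : ℕ) : Φ.FH (n + 1) n = ⊥ := by
  refine eq_bot_iff.2 fun a ha => ?_
  obtain ⟨c, hc, hca⟩ := mem_FH.1 ha
  rw [hΦ.eq_bot _ _ (by omega), Submodule.mem_bot] at hc
  subst hc
  exact hca.eq_zero_iff.2 ⟨0, 0, map_zero _⟩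

/-- The stable values of the spectral sequence are the graded pieces of the cohomology. -/
theorem IsFirstQuadrant.exists_page_equiv_grH (hΦ : Φ.IsFirstQuadrant) (p n : ℕ) (r : ℤ)
    (hp : (p : ℤ) < r) (hn : (n : ℤ) + 1 < r) :
    ∃ ε : (Φ.page r).X (p, n) ≃ₗ[𝔽] Φ.grH p (p + n), ∀ z : Φ.Z r p (p + n),
      ∃ b : Φ.FH p (p + n), IsClassOf K (p + n) z b ∧
        ε (Φ.toPage r (p, n) z) = Submodule.Quotient.mk b := by
  -- The bound `r > n + 1` enters here: elements of `Z_r` are cocycles.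
  have hbot : Φ.F (p + r) (p + n + 1) = ⊥ := hΦ.eq_bot _ _ (by push_cast; omega)
  have hd : ∀ z : Φ.Z r p (p + n), ∀ j, K.d (p + n) j z = 0 := by
    intro z j
    have h1 := z.2.2
    rw [hbot] at h1
    by_cases hj : p + n + 1 = j
    · subst hj
      exact h1
    · rw [K.shape _ _ hj]
      rfl
  obtain ⟨ψ, hψ⟩ := exists_lift_cycles K (Φ.Z r p (p + n)).subtype hd
  have hclass : ∀ z : Φ.Z r p (p + n), IsClassOf K (p + n) z (K.homologyπ (p + n) (ψ z)) :=
    fun z => ⟨ψ z, hψ z, rfl⟩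
  let χ : Φ.Z r p (p + n) →ₗ[𝔽] Φ.FH p (p + n) :=
    ((K.homologyπ (p + n)).hom ∘ₗ ψ).codRestrict _ fun z => mem_FH.2 ⟨z, z.2.1, hclass z⟩
  have hχ : ∀ z : Φ.Z r p (p + n), IsClassOf K (p + n) z (χ z) := hclass
  have hcyc : ∀ (s : ℤ) (c : K.X (p + n)), K.d (p + n) (p + n + 1) c = 0 → c ∈ Φ.F s (p + n) →
      ∀ t, c ∈ Φ.Z t s (p + n) := fun s c hc hs t =>
    Φ.mem_Z.2 ⟨hs, by rw [hc]; exact zero_mem _⟩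
  have hsurj : Function.Surjective
      (((Φ.FH (p + 1) (p + n)).submoduleOf (Φ.FH p (p + n))).mkQ ∘ₗ χ) := by
    refine (Submodule.mkQ_surjective _).comp fun b => ?_
    obtain ⟨c, hc, hcb⟩ := mem_FH.1 b.2
    exact ⟨⟨c, hcyc _ _ (hcb.d_eq_zero _) hc _⟩, Subtype.ext ((hχ _).unique hcb)⟩
  have hker : ∀ z, (((Φ.FH (p + 1) (p + n)).submoduleOf (Φ.FH p (p + n))).mkQ ∘ₗ χ) z = 0 ↔
      (z : K.X (p + n)) ∈ Φ.B r p (p + n) := by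
    intro z
    refine (Submodule.Quotient.mk_eq_zero _).trans ?_
    refine Iff.trans (b := ((χ z : Φ.FH p (p + n)) : K.homology (p + n)) ∈ Φ.FH (p + 1) (p + n))
      Iff.rfl ?_
    rw [mem_FH, mem_B]
    constructor
    · rintro ⟨c, hc, hcz⟩
      obtain ⟨m, b, hb⟩ := ((hχ z).sub hcz).eq_zero_iff.1 (sub_self _)
      have hc' := hcyc _ _ (hcz.d_eq_zero _) hc
      refine ⟨c, hc' _, ?_⟩
      by_cases hm : m + 1 = p + n
      -- The bound `r > p` enters here: `F^{p-r+1}` is everything, so `b` is admissible, as `db = z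
      -- - c` lies in `Fᵖ`.
      · refine ⟨m, b, Φ.mem_Z.2 ⟨?_, ?_⟩, by rw [hb]; abel⟩
        · rw [hΦ.eq_top _ _ (by omega)]
          trivial
        · rw [hm]
          refine Φ.anti _ p _ (by omega) ?_
          rw [hb]
          exact sub_mem z.2.1 (Φ.anti _ _ _ (by omega) hc)
      · refine ⟨0, 0, zero_mem _, ?_⟩
        rw [K.shape _ _ hm] at hb
        rw [map_zero, add_zero]
        exact sub_eq_zero.1 hb.symm
    · rintro ⟨a, ha, m, b, -, hab⟩
      have hda : K.d (p + n) (p + n + 1) a = 0 := by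
        have := hd z (p + n + 1)
        rwa [hab, map_add, d_d_apply, add_zero] at this
      obtain ⟨α, hα⟩ := exists_isClassOf hda
      refine ⟨a, ha.1, ?_⟩
      have : ((χ z : Φ.FH p (p + n)) : K.homology (p + n)) - α = 0 :=
        ((hχ z).sub hα).eq_zero_iff.2 ⟨m, b, by rw [hab]; abel⟩
      rw [sub_eq_zero.1 this]
      exact hα
  exact ⟨quotEquiv _ _ _ hsurj hker, fun z => ⟨χ z, hχ z, quotEquiv_mk _ _ _ hsurj hker z⟩⟩

end Filtration

/-! ### Cochains with their last arguments restricted to a subspace -/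

section Split

variable {𝔽 L H M : Type*} [Field 𝔽] [AddCommGroup L] [Module 𝔽 L] [AddCommGroup H] [Module 𝔽 H]
  [AddCommGroup M] [Module 𝔽 M]

/-- Restriction of multilinear maps along `ι : H → L`. -/
def res (ι : H →ₗ[𝔽] L) (n : ℕ) : ML 𝔽 L M n →ₗ[𝔽] ML 𝔽 H M n where
  toFun f := f.compLinearMap fun _ => ι
  map_add' _ _ := rfl
  map_smul' _ _ := rfl

theorem res_apply (ι : H →ₗ[𝔽] L) (n : ℕ) (f : ML 𝔽 L M n) (y : Fin n → H) :
    res ι n f y = f (ι ∘ y) := rfl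

theorem ins_res (ι : H →ₗ[𝔽] L) (n : ℕ) (f : ML 𝔽 L M (n + 1)) (y : H) :
    ins y n (res ι (n + 1) f) = res ι n (ins (ι y) n f) := by
  ext z
  simp only [ins_apply, res_apply]
  congr 1
  funext i
  refine Fin.cases ?_ (fun i => ?_) i <;> simp

theorem theta_res {ι : H →ₗ[𝔽] L} {D : L →ₗ[𝔽] L} {D' : H →ₗ[𝔽] H} (hD : ∀ y, ι (D' y) = D (ι y))
    (A : M →ₗ[𝔽] M) (n : ℕ) (f : ML 𝔽 L M n) :
    theta A D' n (res ι n f) = res ι n (theta A D n f) := by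
  ext y
  simp only [theta_apply, res_apply]
  congr 1
  refine Finset.sum_congr rfl fun i _ => ?_
  rw [Function.comp_update, hD]
  rfl

/-- The first `p` arguments in `L` and the remaining `n` ones in `H`:
`x ↦ y ↦ f(x₁, …, xₚ, ι y₁, …, ι yₙ)`. -/
def splitRes (ι : H →ₗ[𝔽] L) (p n N : ℕ) (hN : N = p + n) :
    ML 𝔽 L M N →ₗ[𝔽] ML 𝔽 L (ML 𝔽 H M n) p where
  toFun f := (res ι n).compMultilinearMap
    (f.domDomCongr ((finCongr hN).trans finSumFinEquiv.symm)).currySum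
  map_add' _ _ := rfl
  map_smul' _ _ := rfl

theorem splitRes_apply (ι : H →ₗ[𝔽] L) {p n N : ℕ} (hN : N = p + n) (f : ML 𝔽 L M N)
    (x : Fin p → L) (y : Fin n → H) :
    splitRes ι p n N hN f x y = f fun i => Fin.append x (ι ∘ y) (Fin.cast hN i) := by
  change f _ = f _
  congr 1
  funext i
  obtain ⟨j, rfl⟩ := (finCongr hN.symm).surjective i
  obtain ⟨k, rfl⟩ := finSumFinEquiv.surjective j
  rcases k with k | k <;> simp

theorem splitRes_zero (ι : H →ₗ[𝔽] L) {n : ℕ} (hN : n = 0 + n) (f : ML 𝔽 L M n) (x : Fin 0 → L) :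
    splitRes ι 0 n n hN f x = res ι n f := by
  ext y
  rw [splitRes_apply, res_apply, Fin.append_left_nil _ _ rfl]
  rfl

theorem ins_splitRes (ι : H →ₗ[𝔽] L) {p n N : ℕ} (hN : N + 1 = p + 1 + n) (hN' : N = p + n)
    (f : ML 𝔽 L M (N + 1)) (x : L) :
    ins x p (splitRes ι (p + 1) n (N + 1) hN f) = splitRes ι p n N hN' (ins x N f) := by
  subst hN'
  ext z y
  simp only [ins_apply, splitRes_apply]
  congr 1
  funext i
  rw [Fin.append_cons]
  rfl

theorem ins_compMultilinearMap {P : Type*} [AddCommGroup P] [Module 𝔽 P] (A : M →ₗ[𝔽] P) (n : ℕ)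
    (f : ML 𝔽 L M (n + 1)) (x : L) :
    ins x n (A.compMultilinearMap f) = A.compMultilinearMap (ins x n f) := rfl

/-- In the sum defining `theta`, the terms of the last `n` arguments together with `A` form an
operator on the values, and the first `p` arguments keep their own terms. -/
theorem theta_splitRes {ι : H →ₗ[𝔽] L} {D : L →ₗ[𝔽] L} {D' : H →ₗ[𝔽] H}
    (hD : ∀ y, ι (D' y) = D (ι y)) (A : M →ₗ[𝔽] M) {p n N : ℕ} (hN : N = p + n) (f : ML 𝔽 L M N) :
    theta (theta A D' n) D p (splitRes ι p n N hN f) =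
      splitRes ι p n N hN (theta A D N f) := by
  induction p generalizing N with
  | zero =>
    obtain rfl : N = n := by omega
    ext x : 1
    rw [theta_zero_apply, splitRes_zero, splitRes_zero, theta_res hD]
  | succ p ih =>
    obtain ⟨N, rfl⟩ : ∃ N', N = N' + 1 := ⟨p + n, by omega⟩
    have hN' : N = p + n := by omega
    refine ext_ins fun x => ?_
    rw [ins_theta, ins_splitRes ι hN hN', ins_splitRes ι hN hN', ins_splitRes ι hN hN', ih,
      ins_theta, map_add]

theorem splitRes_mem_CS (ι : H →ₗ[𝔽] L) {p n N : ℕ} (hN : N = p + n) {f : ML 𝔽 L M N}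
    (hf : f ∈ CS 𝔽 L M N) (x : Fin p → L) : splitRes ι p n N hN f x ∈ CS 𝔽 H M n := by
  subst hN
  intro σ y
  rw [splitRes_apply, splitRes_apply]
  refine Eq.trans ?_ (hf (finSumFinEquiv.permCongr (Equiv.sumCongr (Equiv.refl _) σ)) _)
  congr 1
  funext i
  obtain ⟨k, rfl⟩ := finSumFinEquiv.surjective i
  rcases k with k | k <;> simp [Equiv.permCongr_apply]

theorem splitRes_symm (ι : H →ₗ[𝔽] L) {p n N : ℕ} (hN : N = p + n) {f : ML 𝔽 L M N}
    (hf : f ∈ CS 𝔽 L M N) : splitRes ι p n N hN f ∈ CS 𝔽 L (ML 𝔽 H M n) p := by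
  subst hN
  intro σ x
  ext y
  rw [splitRes_apply, splitRes_apply]
  refine Eq.trans ?_ (hf (finSumFinEquiv.permCongr (Equiv.sumCongr σ (Equiv.refl _))) _)
  congr 1
  funext i
  obtain ⟨k, rfl⟩ := finSumFinEquiv.surjective i
  rcases k with k | k <;> simp [Equiv.permCongr_apply]

end Split

/-! ### The filtration and the differential in split form -/

section Extension

variable {𝔽 h g q M : Type*} [Field 𝔽]
  [AddCommGroup h] [Module 𝔽 h] [CommLieAlgebra 𝔽 h]
  [AddCommGroup g] [Module 𝔽 g] [CommLieAlgebra 𝔽 g]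
  [AddCommGroup q] [Module 𝔽 q] [CommLieAlgebra 𝔽 q]
  [AddCommGroup M] [Module 𝔽 M]
  (e : CommLieExtension 𝔽 h g q) (ρ : CommLieRep 𝔽 g M)

theorem res_ce (n : ℕ) (f : ML 𝔽 g M n) :
    ce (restrictRep e ρ) n (res e.incl n f) = res e.incl (n + 1) (ce ρ n f) := by
  induction n with
  | zero =>
    refine ext_ins fun y => ?_
    rw [ins_ce_zero, ins_res, ins_ce_zero]
    exact theta_res (e.incl_bracket y) (ρ.act (e.incl y)) 0 f
  | succ n ih =>
    refine ext_ins fun y => ?_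
    rw [ins_ce_succ, ins_res, ins_res, ins_ce_succ, ih, map_add]
    congr 1
    exact theta_res (e.incl_bracket y) (ρ.act (e.incl y)) _ f

theorem splitRes_zero_ce {n N : ℕ} (hN : N + 1 = 0 + (n + 1)) (hN' : N = 0 + n)
    (f : ML 𝔽 g M N) :
    splitRes e.incl 0 (n + 1) (N + 1) hN (ce ρ N f) =
      (ce (restrictRep e ρ) n).compMultilinearMap (splitRes e.incl 0 n N hN' f) := by
  obtain rfl : N = n := by omega
  ext x : 1
  rw [splitRes_zero, LinearMap.compMultilinearMap_apply, splitRes_zero, res_ce]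

/-- By symmetry, `n` arguments lying in `h` can be moved to the last `n` places, so the filtration
level is detected by one restriction. -/
theorem vanishesOn_succ_iff {p n N : ℕ} (hN : N = p + n) {f : ML 𝔽 g M N} (hf : f ∈ CS 𝔽 g M N) :
    VanishesOn e (p + 1) N f ↔ splitRes e.incl p n N hN f = 0 := by
  subst hN
  constructor
  · intro h
    ext x y
    rw [splitRes_apply]
    refine h _ (Finset.univ.map (Fin.natAddEmb p)) (by simp) ?_
    intro i hi
    obtain ⟨j, -, rfl⟩ := Finset.mem_map.1 hi
    simp
  · intro h x S hS hx
    obtain ⟨T, hTS, hT⟩ := Finset.exists_subset_card_eq (n := n) (s := S)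
      (by push_cast at hS; omega)
    let U : Finset (Fin (p + n)) := Finset.univ.map (Fin.natAddEmb p)
    have hU : U.card = T.card := by simp [U, hT]
    -- `T` consists of `n` indices whose arguments lie in `h`; a bijection from the last `n` places
    -- to `T` extends to a permutation.
    let σ : Equiv.Perm (Fin (p + n)) := (Finset.equivOfCardEq hU).extendSubtype
    have hσ : ∀ j : Fin n, ∃ y, e.incl y = x (σ (Fin.natAdd p j)) := by
      intro j
      have hj : Fin.natAdd p j ∈ U := by simp [U]
      exact hx _ (hTS (Equiv.extendSubtype_mem _ _ hj))
    choose y hy using hσ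
    have h1 : f (x ∘ σ) = splitRes e.incl p n (p + n) rfl f (fun i => x (σ (Fin.castAdd n i))) y := by
      rw [splitRes_apply]
      congr 1
      funext i
      refine Fin.addCases (fun i => ?_) (fun i => ?_) i <;> simp [hy]
    rw [← hf σ, h1, h]
    rfl

/-- With the last `n` arguments, an `i`-th argument in `h` makes `n + 1 = N - p + 1` arguments in
`h`. -/
theorem VanishesOn.splitRes_eq_zero {p n N : ℕ} (hN : N = p + n) {f : ML 𝔽 g M N}
    (hf : VanishesOn e p N f) (x : Fin p → g) (i : Fin p) (hi : x i ∈ LinearMap.range e.incl) :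
    splitRes e.incl p n N hN f x = 0 := by
  subst hN
  ext y
  rw [splitRes_apply]
  refine hf _ (insert (Fin.castAdd n i) (Finset.univ.map (Fin.natAddEmb p))) ?_ ?_
  · rw [Finset.card_insert_of_notMem]
    · simp
    · simp [Fin.ext_iff]
      omega
  · intro j hj
    rcases Finset.mem_insert.1 hj with rfl | hj
    · simpa using hi
    · obtain ⟨k, -, rfl⟩ := Finset.mem_map.1 hj
      simp

theorem adj_bracket [CharP 𝔽 2] (x y : g) :
    adj e (lieBr 𝔽 x y) = adj e x ∘ₗ adj e y + adj e y ∘ₗ adj e x := by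
  ext z
  apply e.incl_injective
  simp only [incl_adj, LinearMap.add_apply, LinearMap.comp_apply, map_add]
  have h1 := CommLieAlgebra.jacobi (𝔽 := 𝔽) x y (e.incl z)
  have h2 := add_self (𝔽 := 𝔽) (lieBr 𝔽 (e.incl z) (lieBr 𝔽 x y))
  rw [CommLieAlgebra.bracket_comm (e.incl z) x] at h1
  rw [CommLieAlgebra.bracket_comm (lieBr 𝔽 x y)]
  linear_combination (norm := module) h2 - h1

/-- The action `(x · f)(y₁, …, yₙ) = x · f(y₁, …, yₙ) + ∑ᵢ f(y₁, …, [x, yᵢ], …, yₙ)` of `g` on the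
multilinear cochains of `h`. -/
noncomputable def cochainRep [CharP 𝔽 2] (n : ℕ) : CommLieRep 𝔽 g (ML 𝔽 h M n) where
  act :=
    { toFun := fun x => theta (ρ.act x) (adj e x) n
      map_add' := fun x y => by
        ext f : 1
        rw [map_add, map_add, theta_add]
        rfl
      map_smul' := fun c x => by
        ext f : 1
        rw [map_smul, map_smul, theta_smul]
        rfl }
  act_bracket x y f := by
    change theta _ _ n f = theta _ _ n (theta _ _ n f) + theta _ _ n (theta _ _ n f)
    rw [theta_comm, adj_bracket]
    congr 2
    ext m
    simp [ρ.act_bracket]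

variable [CharP 𝔽 2]

theorem lieDer_splitRes {p n N : ℕ} (hN : N = p + n) (f : ML 𝔽 g M N) (x : g) :
    lieDer (cochainRep e ρ n) x p (splitRes e.incl p n N hN f) =
      splitRes e.incl p n N hN (lieDer ρ x N f) :=
  theta_splitRes (incl_adj e x) (ρ.act x) hN f

/-- With no arguments in `h`, the differential of `f` is that of `f` with coefficients in the
cochains on `h`. -/
theorem splitRes_succ_zero_ce {p N : ℕ} (hN : N + 1 = p + 1 + 0) (hN' : N = p + 0)
    (f : ML 𝔽 g M N) :
    splitRes e.incl (p + 1) 0 (N + 1) hN (ce ρ N f) =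
      ce (cochainRep e ρ 0) p (splitRes e.incl p 0 N hN' f) := by
  induction p generalizing N with
  | zero =>
    obtain rfl : N = 0 := by omega
    refine ext_ins fun x => ?_
    rw [ins_splitRes e.incl hN hN', ins_ce_zero, ins_ce_zero, lieDer_splitRes]
  | succ p ih =>
    obtain ⟨N, rfl⟩ : ∃ N', N = N' + 1 := ⟨p, by omega⟩
    have hN'' : N = p + 0 := by omega
    refine ext_ins fun x => ?_
    rw [ins_splitRes e.incl hN hN', ins_ce_succ, ins_ce_succ, lieDer_splitRes, map_add, ih hN' hN'',
      ins_splitRes e.incl hN' hN'']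

/-- The differential of `f`, with the last arguments in `h`, is the sum of the differential of `f`
with coefficients in the cochains on `h` and the differential of the cochains on `h`. -/
theorem splitRes_succ_succ_ce {p n N : ℕ} (hN : N + 1 = p + 1 + (n + 1)) (hN' : N = p + (n + 1))
    (hN'' : N = p + 1 + n) (f : ML 𝔽 g M N) :
    splitRes e.incl (p + 1) (n + 1) (N + 1) hN (ce ρ N f) =
      ce (cochainRep e ρ (n + 1)) p (splitRes e.incl p (n + 1) N hN' f) +
        (ce (restrictRep e ρ) n).compMultilinearMap (splitRes e.incl (p + 1) n N hN'' f) := by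
  induction p generalizing N with
  | zero =>
    obtain rfl : N = n + 1 := by omega
    have h1 : n = 0 + n := by omega
    refine ext_ins fun x => ?_
    rw [map_add, ins_splitRes e.incl hN hN', ins_ce_succ, map_add, ← lieDer_splitRes e ρ hN',
      ins_compMultilinearMap, ins_splitRes e.incl hN'' h1, ins_ce_zero,
      splitRes_zero_ce e ρ hN' h1]
  | succ p ih =>
    obtain ⟨N, rfl⟩ : ∃ N', N = N' + 1 := ⟨p + (n + 1), by omega⟩
    have h1 : N = p + 1 + n := by omega
    have h2 : N = p + (n + 1) := by omega
    -- After inserting `x`, Cartan's formula applies to both differentials over `g`; the Lie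
    -- derivatives agree by `lieDer_splitRes`, and what remains is the induction hypothesis for `i_x
    -- f`.
    refine ext_ins fun x => ?_
    rw [map_add, ins_splitRes e.incl hN hN', ins_ce_succ, ins_ce_succ, map_add,
      ← lieDer_splitRes e ρ hN', ins_compMultilinearMap, ins_splitRes e.incl hN'' h1,
      ins_splitRes e.incl hN' h2, ih hN' h2 h1, add_assoc]

end Extension

/-! ### Extending split cochains by shuffles -/

section Shuffle

variable {𝔽 L Q H M P : Type*} [Field 𝔽] [AddCommGroup L] [Module 𝔽 L]
  [AddCommGroup Q] [Module 𝔽 Q] [AddCommGroup H] [Module 𝔽 H]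
  [AddCommGroup M] [Module 𝔽 M] [AddCommGroup P] [Module 𝔽 P]

variable (𝔽 L M) in
/-- The insertion operator `(x, f) ↦ i_x f` as a bilinear map. -/
def insₗ (n : ℕ) : L →ₗ[𝔽] ML 𝔽 L M (n + 1) →ₗ[𝔽] ML 𝔽 L M n where
  toFun x := ins x n
  map_add' x y := LinearMap.ext fun f => ins_add x y n f
  map_smul' c x := LinearMap.ext fun f => ins_smul c x n f

variable (𝔽 Q H M) in
/-- Insertion into the values: `(y, F) ↦ (x ↦ i_y F(x))`. -/
def insVal (p n : ℕ) : H →ₗ[𝔽] ML 𝔽 Q (ML 𝔽 H M (n + 1)) p →ₗ[𝔽] ML 𝔽 Q (ML 𝔽 H M n) p :=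
  LinearMap.mk₂ 𝔽 (fun y F => (ins y n).compMultilinearMap F)
    (fun y y' F => by ext1 x; exact ins_add y y' n (F x))
    (fun c y F => by ext1 x; exact ins_smul c y n (F x))
    (fun y F F' => by ext1 x; exact map_add (ins y n) (F x) (F' x))
    (fun c y F => by ext1 x; exact map_smul (ins y n) c (F x))

theorem insVal_apply (p n : ℕ) (y : H) (F : ML 𝔽 Q (ML 𝔽 H M (n + 1)) p) (x : Fin p → Q) :
    insVal 𝔽 Q H M p n y F x = ins y n (F x) := rfl

/-- The multilinear map with `i_x f = A x v`. -/
def uncurryIns {n : ℕ} (A : L →ₗ[𝔽] P →ₗ[𝔽] ML 𝔽 L M n) : P →ₗ[𝔽] ML 𝔽 L M (n + 1) where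
  toFun v := (A.flip v).uncurryLeft
  map_add' v w := by ext; simp
  map_smul' c v := by ext; simp

theorem ins_uncurryIns {n : ℕ} (A : L →ₗ[𝔽] P →ₗ[𝔽] ML 𝔽 L M n) (v : P) (x : L) :
    ins x n (uncurryIns A v) = A x v := by
  ext y
  simp [ins_apply, uncurryIns]

/-- The extension of `F` to a multilinear map on `L`,
`(z₁, …, z_N) ↦ ∑_S F(pr z_S)(π z_{Sᶜ})`, the sum over the `p`-element sets `S` of indices. -/
def shuffle (pr : L →ₗ[𝔽] Q) (π : L →ₗ[𝔽] H) :
    (N p n : ℕ) → N = p + n → (ML 𝔽 Q (ML 𝔽 H M n) p →ₗ[𝔽] ML 𝔽 L M N)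
  | 0, _, _, _ =>
    { toFun := fun F => MultilinearMap.constOfIsEmpty 𝔽 _ (F 0 0)
      map_add' := fun _ _ => rfl
      map_smul' := fun _ _ => rfl }
  | _ + 1, 0, 0, _ => 0
  | N + 1, p + 1, 0, _ =>
    uncurryIns ((insₗ 𝔽 Q _ p ∘ₗ pr).compr₂ (shuffle pr π N p 0 (by omega)))
  | N + 1, 0, n + 1, _ =>
    uncurryIns ((insVal 𝔽 Q H M 0 n ∘ₗ π).compr₂ (shuffle pr π N 0 n (by omega)))
  | N + 1, p + 1, n + 1, _ =>
    uncurryIns ((insₗ 𝔽 Q _ p ∘ₗ pr).compr₂ (shuffle pr π N p (n + 1) (by omega)) +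
      (insVal 𝔽 Q H M (p + 1) n ∘ₗ π).compr₂ (shuffle pr π N (p + 1) n (by omega)))

variable (pr : L →ₗ[𝔽] Q) (π : L →ₗ[𝔽] H)

theorem shuffle_zero (F : ML 𝔽 Q (ML 𝔽 H M 0) 0) (z : Fin 0 → L) :
    shuffle pr π 0 0 0 rfl F z = F 0 0 := rfl

theorem ins_shuffle_succ_zero {N p : ℕ} (hN : N + 1 = p + 1 + 0) (hN' : N = p + 0)
    (F : ML 𝔽 Q (ML 𝔽 H M 0) (p + 1)) (x : L) :
    ins x N (shuffle pr π (N + 1) (p + 1) 0 hN F) =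
      shuffle pr π N p 0 hN' (ins (pr x) p F) := by
  rw [shuffle, ins_uncurryIns]
  rfl

theorem ins_shuffle_zero_succ {N n : ℕ} (hN : N + 1 = 0 + (n + 1)) (hN' : N = 0 + n)
    (F : ML 𝔽 Q (ML 𝔽 H M (n + 1)) 0) (x : L) :
    ins x N (shuffle pr π (N + 1) 0 (n + 1) hN F) =
      shuffle pr π N 0 n hN' (insVal 𝔽 Q H M 0 n (π x) F) := by
  rw [shuffle, ins_uncurryIns]
  rfl

/-- The two terms collect the sets `S` that contain the first index and those that do not. -/
theorem ins_shuffle_succ_succ {N p n : ℕ} (hN : N + 1 = p + 1 + (n + 1)) (h1 : N = p + (n + 1))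
    (h2 : N = p + 1 + n) (F : ML 𝔽 Q (ML 𝔽 H M (n + 1)) (p + 1)) (x : L) :
    ins x N (shuffle pr π (N + 1) (p + 1) (n + 1) hN F) =
      shuffle pr π N p (n + 1) h1 (ins (pr x) p F) +
        shuffle pr π N (p + 1) n h2 (insVal 𝔽 Q H M (p + 1) n (π x) F) := by
  rw [shuffle, ins_uncurryIns]
  rfl

theorem insVal_symm {p n : ℕ} {F : ML 𝔽 Q (ML 𝔽 H M (n + 1)) p}
    (hF : F ∈ CS 𝔽 Q (ML 𝔽 H M (n + 1)) p) (y : H) :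
    insVal 𝔽 Q H M p n y F ∈ CS 𝔽 Q (ML 𝔽 H M n) p := fun σ x => by
  rw [insVal_apply, insVal_apply, hF]

theorem insVal_insVal {p n : ℕ} {F : ML 𝔽 Q (ML 𝔽 H M (n + 2)) p}
    (hF : ∀ x, F x ∈ CS 𝔽 H M (n + 2)) (y z : H) :
    insVal 𝔽 Q H M p n y (insVal 𝔽 Q H M p (n + 1) z F) =
      insVal 𝔽 Q H M p n z (insVal 𝔽 Q H M p (n + 1) y F) := by
  ext1 x
  exact ins_ins_of_mem_CS (hF x) y z

theorem ins_insVal {p n : ℕ} (F : ML 𝔽 Q (ML 𝔽 H M (n + 1)) (p + 1)) (x : Q) (y : H) :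
    ins x p (insVal 𝔽 Q H M (p + 1) n y F) = insVal 𝔽 Q H M p n y (ins x p F) := rfl

/-- It suffices to exchange the first two arguments. Expanding `i_x i_y` gives a term with both in
`Q`, a term with both in `H`, each symmetric by assumption, and two mixed terms that are
interchanged. -/
theorem shuffle_mem_CS {N p n : ℕ} (hN : N = p + n) {F : ML 𝔽 Q (ML 𝔽 H M n) p}
    (hF : F ∈ CS 𝔽 Q (ML 𝔽 H M n) p) (hF' : ∀ x, F x ∈ CS 𝔽 H M n) :
    shuffle pr π N p n hN F ∈ CS 𝔽 L M N := by
  induction N generalizing p n with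
  | zero => exact mem_CS_zero _
  | succ N ih =>
    cases N with
    | zero => exact mem_CS_one _
    | succ N =>
      rcases p with _ | p
      · obtain rfl : n = N + 2 := by omega
        have h1 : N + 1 = 0 + (N + 1) := by omega
        have h2 : N = 0 + N := by omega
        refine mem_CS_of_ins (fun x => ?_) fun x y => ?_
        · rw [ins_shuffle_zero_succ _ _ hN h1]
          exact ih _ (insVal_symm hF _) fun z => ins_mem_CS (hF' z) _
        · simp only [ins_shuffle_zero_succ _ _ hN h1, ins_shuffle_zero_succ _ _ h1 h2]
          rw [insVal_insVal hF']
      · rcases n with _ | n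
        · obtain rfl : p = N + 1 := by omega
          have h1 : N + 1 = N + 1 + 0 := by omega
          refine mem_CS_of_ins (fun x => ?_) fun x y => ?_
          · rw [ins_shuffle_succ_zero _ _ hN h1]
            exact ih _ (ins_mem_CS hF _) fun z => hF' _
          · simp only [ins_shuffle_succ_zero _ _ hN h1, ins_shuffle_succ_zero _ _ h1 rfl]
            rw [ins_ins_of_mem_CS hF]
        · have h1 : N + 1 = p + (n + 1) := by omega
          have h2 : N + 1 = p + 1 + n := by omega
          refine mem_CS_of_ins (fun x => ?_) fun x y => ?_
          · rw [ins_shuffle_succ_succ _ _ hN h1 h2]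
            exact add_mem (ih _ (ins_mem_CS hF _) fun z => hF' _)
              (ih _ (insVal_symm hF _) fun z => ins_mem_CS (hF' z) _)
          · simp only [ins_shuffle_succ_succ _ _ hN h1 h2, map_add]
            have h3 : N = p + n := by omega
            -- The recursion loses a term once no argument of one kind is left, whence the four
            -- cases.
            rcases p with _ | p <;> rcases n with _ | n
            · simp only [ins_shuffle_zero_succ _ _ h1 h3, ins_shuffle_succ_zero _ _ h2 h3,
                ins_insVal]
              abel
            · have h4 : N = 0 + 1 + n := by omega
              simp only [ins_shuffle_zero_succ _ _ h1 h3, ins_shuffle_succ_succ _ _ h2 h3 h4,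
                ins_insVal]
              rw [insVal_insVal hF']
              abel
            · have h4 : N = p + 1 := by omega
              simp only [ins_shuffle_succ_succ _ _ h1 h4 h3, ins_shuffle_succ_zero _ _ h2 h3,
                ins_insVal]
              rw [ins_ins_of_mem_CS hF]
              abel
            · have h4 : N = p + (n + 2) := by omega
              have h5 : N = p + 2 + n := by omega
              simp only [ins_shuffle_succ_succ _ _ h1 h4 h3, ins_shuffle_succ_succ _ _ h2 h3 h5,
                ins_insVal]
              rw [ins_ins_of_mem_CS hF, insVal_insVal hF']
              abel

variable {pr π} {ι : H →ₗ[𝔽] L}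

theorem ins_zero (n : ℕ) (f : ML 𝔽 L M (n + 1)) : ins 0 n f = 0 := map_zero f.curryLeft

theorem res_shuffle_succ (hpr : ∀ y, pr (ι y) = 0) {N p n : ℕ} (hN : N = p + 1 + n)
    (F : ML 𝔽 Q (ML 𝔽 H M n) (p + 1)) :
    res ι N (shuffle pr π N (p + 1) n hN F) = 0 := by
  induction n generalizing N with
  | zero =>
    obtain rfl : N = p + 1 := by omega
    refine ext_ins fun y => ?_
    rw [ins_res, ins_shuffle_succ_zero _ _ hN rfl, hpr, ins_zero, map_zero, map_zero, map_zero]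
  | succ n ih =>
    obtain ⟨N, rfl⟩ : ∃ N', N = N' + 1 := ⟨p + (n + 1), by omega⟩
    have h1 : N = p + (n + 1) := by omega
    have h2 : N = p + 1 + n := by omega
    refine ext_ins fun y => ?_
    rw [ins_res, ins_shuffle_succ_succ _ _ hN h1 h2, hpr, ins_zero, map_zero, zero_add, ih,
      map_zero]

/-- Only `k < p` arguments are outside `H`, so every `p`-element set `S` contains an index whose
argument is killed by `pr`. -/
theorem splitRes_shuffle_of_lt (hpr : ∀ y, pr (ι y) = 0) {N k m p n : ℕ} (hN : N = k + m)
    (hN' : N = p + n) (hk : k < p) (F : ML 𝔽 Q (ML 𝔽 H M n) p) :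
    splitRes ι k m N hN (shuffle pr π N p n hN' F) = 0 := by
  induction k generalizing N p n with
  | zero =>
    obtain ⟨p, rfl⟩ : ∃ p', p = p' + 1 := ⟨p - 1, by omega⟩
    obtain rfl : m = N := by omega
    ext1 x
    rw [splitRes_zero, res_shuffle_succ hpr]
    rfl
  | succ k ih =>
    obtain ⟨p, rfl⟩ : ∃ p', p = p' + 1 := ⟨p - 1, by omega⟩
    obtain ⟨N, rfl⟩ : ∃ N', N = N' + 1 := ⟨N - 1, by omega⟩
    have h0 : N = k + m := by omega
    have h1 : N = p + n := by omega
    refine ext_ins fun x => ?_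
    rw [ins_splitRes ι hN h0, map_zero]
    rcases n with _ | n
    · rw [ins_shuffle_succ_zero _ _ hN' h1, ih h0 h1 (by omega)]
    · rw [ins_shuffle_succ_succ _ _ hN' h1 (by omega), map_add, ih h0 h1 (by omega),
        ih h0 _ (by omega), add_zero]

theorem res_shuffle_zero (hπ : ∀ y, π (ι y) = y) {n : ℕ} (hN : n = 0 + n)
    (F : ML 𝔽 Q (ML 𝔽 H M n) 0) (x : Fin 0 → Q) :
    res ι n (shuffle pr π n 0 n hN F) = F x := by
  induction n with
  | zero =>
    ext y
    rw [res_apply, shuffle_zero, Subsingleton.elim x 0, Subsingleton.elim y 0]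
  | succ n ih =>
    refine ext_ins fun y => ?_
    have h1 : n = 0 + n := by omega
    rw [ins_res, ins_shuffle_zero_succ _ _ hN h1, ih, hπ, insVal_apply]

/-- Only the set `S` of the first `p` indices avoids the arguments in `H`, and on these `π` is the
identity. -/
theorem splitRes_shuffle (hpr : ∀ y, pr (ι y) = 0) (hπ : ∀ y, π (ι y) = y) {N p n : ℕ}
    (hN : N = p + n) (F : ML 𝔽 Q (ML 𝔽 H M n) p) :
    splitRes ι p n N hN (shuffle pr π N p n hN F) = res pr p F := by
  induction p generalizing N with
  | zero =>
    obtain rfl : n = N := by omega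
    ext1 x
    rw [splitRes_zero, res_shuffle_zero hπ, res_apply]
  | succ p ih =>
    obtain ⟨N, rfl⟩ : ∃ N', N = N' + 1 := ⟨N - 1, by omega⟩
    have h0 : N = p + n := by omega
    refine ext_ins fun x => ?_
    rw [ins_splitRes ι hN h0, ins_res]
    rcases n with _ | n
    · rw [ins_shuffle_succ_zero _ _ hN h0, ih]
    · rw [ins_shuffle_succ_succ _ _ hN h0 (by omega), map_add, ih,
        splitRes_shuffle_of_lt hpr _ _ (by omega), add_zero]

end Shuffle

/-! ### Linear choices of classes, representatives and primitives -/

section ClassMap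

universe v

variable {𝔽 : Type u} {L : Type v} {M : Type w} [Field 𝔽] [AddCommGroup L] [Module 𝔽 L]
  [AddCommGroup M] [Module 𝔽 M] [CommLieAlgebra 𝔽 L] (ρ : CommLieRep 𝔽 L M)

/-- A linear choice of primitives of the coboundaries. -/
theorem exists_primitive (n : ℕ) : ∃ τ : ML 𝔽 L M (n + 1) →ₗ[𝔽] ML 𝔽 L M n,
    (∀ f, τ f ∈ CS 𝔽 L M n) ∧ ∀ f ∈ CS 𝔽 L M n, ce ρ n (τ (ce ρ n f)) = ce ρ n f := by
  let D := ce ρ n ∘ₗ (CS 𝔽 L M n).subtype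
  -- Over a field the differential has a linear section on its image. Extending it to all
  -- multilinear maps allows composition with split cochains, with no membership condition on their
  -- values.
  obtain ⟨r, hr⟩ := D.rangeRestrict.exists_rightInverse_of_surjective D.range_rangeRestrict
  obtain ⟨t, ht⟩ := r.exists_extend
  refine ⟨(CS 𝔽 L M n).subtype ∘ₗ t, fun f => (t f).2, fun f hf => ?_⟩
  have h1 : t (ce ρ n f) = r (D.rangeRestrict ⟨f, hf⟩) :=
    LinearMap.congr_fun ht (D.rangeRestrict ⟨f, hf⟩)
  have h2 := congrArg Subtype.val (LinearMap.congr_fun hr (D.rangeRestrict ⟨f, hf⟩))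
  rw [LinearMap.comp_apply, h1]
  exact h2

variable [CharP 𝔽 2]

theorem exists_ev_eq {n : ℕ} {f : ML 𝔽 L M n} (hf : f ∈ CS 𝔽 L M n) :
    ∃ w : (csComplex ρ).X n, ev ρ n w = f := ⟨(⟨f, hf⟩ : CS 𝔽 L M n), rfl⟩

/-- `c` sends each symmetric cocycle to its cohomology class. -/
def IsClassMap (n : ℕ) (c : ML 𝔽 L M n →ₗ[𝔽] HS ρ n) : Prop :=
  ∀ w a, IsClassOf (csComplex ρ) n w a → c (ev ρ n w) = a

theorem exists_isClassMap (n : ℕ) : ∃ c, IsClassMap ρ n c := by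
  obtain ⟨l, hl⟩ := (ev ρ n ∘ₗ ((csComplex ρ).iCycles n).hom).exists_leftInverse_of_injective
    (LinearMap.ker_eq_bot.2 ((ev_injective ρ n).comp (iCycles_injective _ n)))
  refine ⟨((csComplex ρ).homologyπ n).hom ∘ₗ l, ?_⟩
  rintro _ _ ⟨k, rfl, rfl⟩
  exact congrArg ((csComplex ρ).homologyπ n).hom (LinearMap.congr_fun hl k)

/-- A linear choice of representatives of the cohomology classes. -/
theorem exists_classSection (n : ℕ) : ∃ σ : HS ρ n →ₗ[𝔽] (csComplex ρ).X n,
    ∀ a, IsClassOf (csComplex ρ) n (σ a) a := by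
  obtain ⟨r, hr⟩ := ((csComplex ρ).homologyπ n).hom.exists_rightInverse_of_surjective
    (LinearMap.range_eq_top.2 (homologyπ_surjective _ n))
  exact ⟨((csComplex ρ).iCycles n).hom ∘ₗ r, fun a => ⟨r a, rfl, LinearMap.congr_fun hr a⟩⟩

variable {ρ} {n : ℕ} {c : ML 𝔽 L M n →ₗ[𝔽] HS ρ n}

theorem IsClassMap.isClassOf (hc : IsClassMap ρ n c) {w : (csComplex ρ).X n}
    (hw : ce ρ n (ev ρ n w) = 0) : IsClassOf (csComplex ρ) n w (c (ev ρ n w)) := by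
  obtain ⟨a, ha⟩ := exists_isClassOf (K := csComplex ρ) (c := w)
    (ev_injective ρ (n + 1) (by rw [ev_d, hw, map_zero]))
  rw [hc w a ha]
  exact ha

theorem IsClassMap.apply_ce {c : ML 𝔽 L M (n + 1) →ₗ[𝔽] HS ρ (n + 1)}
    (hc : IsClassMap ρ (n + 1) c) {f : ML 𝔽 L M n} (hf : f ∈ CS 𝔽 L M n) : c (ce ρ n f) = 0 := by
  obtain ⟨w, rfl⟩ := exists_ev_eq ρ hf
  have h1 := hc.isClassOf (w := (csComplex ρ).d n (n + 1) w) (by rw [ev_d, ce_ce])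
  rw [← ev_d]
  exact h1.eq_zero_iff.2 ⟨n, w, rfl⟩

theorem IsClassMap.exists_ce_eq {c : ML 𝔽 L M (n + 1) →ₗ[𝔽] HS ρ (n + 1)}
    (hc : IsClassMap ρ (n + 1) c) {f : ML 𝔽 L M (n + 1)} (hf : f ∈ CS 𝔽 L M (n + 1))
    (hd : ce ρ (n + 1) f = 0) (h0 : c f = 0) : ∃ b ∈ CS 𝔽 L M n, ce ρ n b = f := by
  obtain ⟨w, rfl⟩ := exists_ev_eq ρ hf
  obtain ⟨m, b, hb⟩ := (hc.isClassOf hd).eq_zero_iff.1 h0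
  by_cases hm : m = n
  · subst hm
    exact ⟨ev ρ m b, ev_mem ρ m b, by rw [← hb, ev_d]⟩
  · rw [(csComplex ρ).shape m (n + 1) (by simpa using hm)] at hb
    refine ⟨0, zero_mem _, ?_⟩
    rw [← hb, map_zero]
    exact (map_zero _).symm

theorem IsClassMap.eq_zero {c : ML 𝔽 L M 0 →ₗ[𝔽] HS ρ 0}
    (hc : IsClassMap ρ 0 c) {f : ML 𝔽 L M 0} (hd : ce ρ 0 f = 0) (h0 : c f = 0) : f = 0 := by
  obtain ⟨w, rfl⟩ := exists_ev_eq ρ (mem_CS_zero f)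
  obtain ⟨m, b, hb⟩ := (hc.isClassOf hd).eq_zero_iff.1 h0
  rw [(csComplex ρ).shape m 0 (by simp)] at hb
  rw [← hb]
  exact map_zero _

end ClassMap

/-- Coordinates are exchanged one at a time; each exchange alters `F` by a value having a coordinate
in `K`. -/
theorem map_eq_map_of_sub_mem {𝔽 L P : Type*} [Field 𝔽] [AddCommGroup L] [Module 𝔽 L]
    [AddCommGroup P] [Module 𝔽 P] {p : ℕ} (F : ML 𝔽 L P p) (K : Submodule 𝔽 L)
    (hF : ∀ x i, x i ∈ K → F x = 0) {x x' : Fin p → L} (h : ∀ i, x i - x' i ∈ K) : F x = F x' := by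
  have key : ∀ t : Finset (Fin p), F (t.piecewise x x') = F x' := by
    intro t
    induction t using Finset.induction with
    | empty => rw [Finset.piecewise_empty]
    | insert i t hi ih =>
      rw [Finset.piecewise_insert, ← ih, ← sub_eq_zero]
      have h1 : t.piecewise x x' = Function.update (t.piecewise x x') i (x' i) := by
        rw [Function.eq_update_self_iff]
        simp [hi]
      conv_lhs => rw [h1]
      rw [Function.update_idem, ← MultilinearMap.map_update_sub]
      exact hF _ i (by rw [Function.update_self]; exact h i)
  simpa using key Finset.univ

/-! ### Cochains on the quotient induced by cochains on `g` -/

section HochschildSerre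

variable {𝔽 : Type u} {h : Type vh} {g : Type vg} {q : Type vq} {M : Type w} [Field 𝔽]
  [AddCommGroup h] [Module 𝔽 h] [CommLieAlgebra 𝔽 h]
  [AddCommGroup g] [Module 𝔽 g] [CommLieAlgebra 𝔽 g]
  [AddCommGroup q] [Module 𝔽 q] [CommLieAlgebra 𝔽 q]
  [AddCommGroup M] [Module 𝔽 M]
  {e : CommLieExtension 𝔽 h g q} {ρ : CommLieRep 𝔽 g M}

theorem VanishesOn.splitRes_congr {p n N : ℕ} (hN : N = p + n) {f : ML 𝔽 g M N}
    (hf : VanishesOn e p N f) {x x' : Fin p → g} (hx : e.proj ∘ x = e.proj ∘ x') :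
    splitRes e.incl p n N hN f x = splitRes e.incl p n N hN f x' := by
  refine map_eq_map_of_sub_mem _ (LinearMap.range e.incl)
    (fun y i hi => hf.splitRes_eq_zero e hN y i hi) fun i => ?_
  refine (e.exact _).1 ?_
  rw [map_sub, sub_eq_zero]
  exact congrFun hx i

theorem shuffle_vanishesOn {π : g →ₗ[𝔽] h} {p n N : ℕ} (hN : N = p + n)
    {F : ML 𝔽 q (ML 𝔽 h M n) p} (hF : shuffle e.proj π N p n hN F ∈ CS 𝔽 g M N) :
    VanishesOn e p N (shuffle e.proj π N p n hN F) := by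
  cases p with
  | zero =>
    -- Membership in `F⁰` is an empty condition: it concerns sets of at least `N + 1` among `N`
    -- indices.
    intro x S hS
    have := S.card_le_univ
    rw [Fintype.card_fin] at this
    push_cast at hS
    omega
  | succ p =>
    have h1 : N = p + (n + 1) := by omega
    push_cast
    rw [vanishesOn_succ_iff e h1 hF]
    exact splitRes_shuffle_of_lt e.exact.apply_apply_eq_zero _ _ (by omega) _

variable [CharP 𝔽 2]

/-- This computes `d₀`: in the split formula for `df`, the other term restricts one more argument of
`f` to `h` and vanishes because `f ∈ Fᵖ`. -/
theorem splitRes_ce_of_vanishesOn {p n N : ℕ} (hN : N = p + n) (hN' : N + 1 = p + (n + 1))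
    {f : ML 𝔽 g M N} (hf : f ∈ CS 𝔽 g M N) (hfp : VanishesOn e p N f) :
    splitRes e.incl p (n + 1) (N + 1) hN' (ce ρ N f) =
      (ce (restrictRep e ρ) n).compMultilinearMap (splitRes e.incl p n N hN f) := by
  cases p with
  | zero => exact splitRes_zero_ce e ρ hN' hN f
  | succ p =>
    have h1 : N = p + (n + 1) := by omega
    push_cast at hfp
    rw [splitRes_succ_succ_ce e ρ hN' h1 hN, (vanishesOn_succ_iff e h1 hf).1 hfp, map_zero, zero_add]

theorem ce_splitRes_eq_zero {p n N : ℕ} (hN : N = p + n) {f : ML 𝔽 g M N}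
    (hf : f ∈ CS 𝔽 g M N) (hfp : VanishesOn e p N f) (hd : VanishesOn e (p + 1) (N + 1) (ce ρ N f))
    (x : Fin p → g) : ce (restrictRep e ρ) n (splitRes e.incl p n N hN f x) = 0 := by
  have h1 : N + 1 = p + (n + 1) := by omega
  have h2 := splitRes_ce_of_vanishesOn (ρ := ρ) hN h1 hf hfp
  rw [(vanishesOn_succ_iff e h1 (ce_mem_CS ρ hf)).1 hd] at h2
  exact (congrArg (fun F : ML 𝔽 g (ML 𝔽 h M (n + 1)) p => F x) h2).symm

theorem IsClassMap.actHS_apply {n : ℕ} {c : ML 𝔽 h M n →ₗ[𝔽] HS (restrictRep e ρ) n}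
    (hc : IsClassMap (restrictRep e ρ) n c) (x : g) {f : ML 𝔽 h M n} (hf : f ∈ CS 𝔽 h M n)
    (hd : ce (restrictRep e ρ) n f = 0) :
    actHS e ρ n x (c f) = c ((cochainRep e ρ n).act x f) := by
  obtain ⟨w, rfl⟩ := exists_ev_eq (restrictRep e ρ) hf
  obtain ⟨k, hk, hkc⟩ := hc.isClassOf hd
  refine (hc ((thetaHom (isDerPair_adj e ρ x)).f n w) _
    ⟨HomologicalComplex.cyclesMap (thetaHom (isDerPair_adj e ρ x)) n k, ?_, ?_⟩).symm
  · rw [← ModuleCat.comp_apply, HomologicalComplex.cyclesMap_i, ModuleCat.comp_apply, hk]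
  · rw [← ModuleCat.comp_apply, ← HomologicalComplex.homologyπ_naturality, ModuleCat.comp_apply,
      hkc]
    rfl

/-- The cochain on `q` with values in `HSⁿ(h, M)` induced by a cochain on `g`, defined by means of a
section `s` of `g → q` and a class map `c`. -/
noncomputable def inducedML {n : ℕ} (c : ML 𝔽 h M n →ₗ[𝔽] HS (restrictRep e ρ) n) (s : q →ₗ[𝔽] g)
    (p N : ℕ) (hN : N = p + n) : ML 𝔽 g M N →ₗ[𝔽] ML 𝔽 q (HS (restrictRep e ρ) n) p where
  toFun f := c.compMultilinearMap (res s p (splitRes e.incl p n N hN f))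
  map_add' f f' := by ext; simp
  map_smul' a f := by ext; simp

theorem inducedML_apply {n : ℕ} (c : ML 𝔽 h M n →ₗ[𝔽] HS (restrictRep e ρ) n) (s : q →ₗ[𝔽] g)
    {p N : ℕ} (hN : N = p + n) (f : ML 𝔽 g M N) (x : Fin p → q) :
    inducedML c s p N hN f x = c (splitRes e.incl p n N hN f (s ∘ x)) := rfl

variable {n : ℕ} {c : ML 𝔽 h M n →ₗ[𝔽] HS (restrictRep e ρ) n} {s : q →ₗ[𝔽] g}

/-- On `Fᵖ` the choice of the section `s` is immaterial, so the arguments may be lifted to `g`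
arbitrarily. -/
theorem VanishesOn.inducedML_comp_proj (hs : ∀ x, e.proj (s x) = x) {p N : ℕ} (hN : N = p + n)
    {f : ML 𝔽 g M N} (hf : VanishesOn e p N f) (x : Fin p → g) :
    inducedML c s p N hN f (e.proj ∘ x) = c (splitRes e.incl p n N hN f x) := by
  rw [inducedML_apply]
  congr 1
  exact hf.splitRes_congr hN (funext fun i => hs _)

/-- This computes `d₁`. The second term of the split formula is a coboundary on `h`, invisible to
classes. In the first, all values are cocycles, so `g` acts on their classes through `q`. -/
theorem inducedML_ce (hc : IsClassMap (restrictRep e ρ) n c) (hs : ∀ x, e.proj (s x) = x)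
    {p N : ℕ} (hN : N = p + n) (hN' : N + 1 = p + 1 + n) {f : ML 𝔽 g M N} (hf : f ∈ CS 𝔽 g M N)
    (hfp : VanishesOn e p N f) (hd : VanishesOn e (p + 1) (N + 1) (ce ρ N f)) :
    inducedML c s (p + 1) (N + 1) hN' (ce ρ N f) =
      ce (quotRep e ρ n) p (inducedML c s p N hN f) := by
  ext x
  have h1 : ce (quotRep e ρ n) p (inducedML c s p N hN f) x =
      c (ce (cochainRep e ρ n) p (splitRes e.incl p n N hN f) (s ∘ x)) := by
    rw [ce_apply, ce_apply, ceSum, ceSum, map_add, map_sum, map_sum]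
    congr 1
    · refine Finset.sum_congr rfl fun i _ => ?_
      rw [← hs (x i), quotRep_act_proj, inducedML_apply, hc.actHS_apply _
        (splitRes_mem_CS _ hN hf _) (ce_splitRes_eq_zero hN hf hfp hd _)]
      rfl
    · refine Finset.sum_congr rfl fun i _ => ?_
      rw [map_sum]
      refine Finset.sum_congr rfl fun j _ => ?_
      split_ifs
      -- The section need not respect brackets, but `s [xᵢ, xⱼ]` and `[s xᵢ, s xⱼ]` have the same
      -- image in `q`, which is all that matters for `f ∈ Fᵖ`.
      · rw [← hfp.inducedML_comp_proj hs]
        congr 1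
        rw [Function.comp_update, e.proj_bracket]
        simp only [Function.comp_apply, hs]
        congr 1
        funext k
        exact (hs _).symm
      · rw [map_zero]
  rw [h1, inducedML_apply]
  cases n with
  | zero => rw [splitRes_succ_zero_ce e ρ hN' hN]
  | succ n =>
    rw [splitRes_succ_succ_ce e ρ hN' hN (by omega : N = p + 1 + n), add_apply, map_add,
      LinearMap.compMultilinearMap_apply, hc.apply_ce (splitRes_mem_CS _ _ hf _), add_zero]

theorem inducedML_mem_CS (c : ML 𝔽 h M n →ₗ[𝔽] HS (restrictRep e ρ) n) (s : q →ₗ[𝔽] g) {p N : ℕ}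
    (hN : N = p + n) {f : ML 𝔽 g M N} (hf : f ∈ CS 𝔽 g M N) :
    inducedML c s p N hN f ∈ CS 𝔽 q (HS (restrictRep e ρ) n) p := fun σ x => by
  rw [inducedML_apply, inducedML_apply, ← Function.comp_assoc, splitRes_symm _ hN hf]

/-- A symmetric cochain on `q` with values in `HSⁿ(h, M)` is induced by a cochain on `g`. -/
theorem exists_inducedML_eq (hc : IsClassMap (restrictRep e ρ) n c) (hs : ∀ x, e.proj (s x) = x)
    {p N : ℕ} (hN : N = p + n) {φ : ML 𝔽 q (HS (restrictRep e ρ) n) p}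
    (hφ : φ ∈ CS 𝔽 q (HS (restrictRep e ρ) n) p) :
    ∃ f ∈ CS 𝔽 g M N, VanishesOn e p N f ∧ VanishesOn e (p + 1) (N + 1) (ce ρ N f) ∧
      inducedML c s p N hN f = φ := by
  obtain ⟨σ, hσ⟩ := exists_classSection (restrictRep e ρ) n
  obtain ⟨π, hπ⟩ := e.incl.exists_leftInverse_of_injective
    (LinearMap.ker_eq_bot.2 e.incl_injective)
  -- The values of `φ` are replaced by linearly chosen cocycles; being cocycles, they are
  -- annihilated by `d₀`, which puts the differential of the shuffle in `Fᵖ⁺¹`.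
  let F : ML 𝔽 q (ML 𝔽 h M n) p := (ev (restrictRep e ρ) n ∘ₗ σ).compMultilinearMap φ
  have hF : shuffle e.proj π N p n hN F ∈ CS 𝔽 g M N :=
    shuffle_mem_CS _ _ hN (fun τ x => by
      simp only [F, LinearMap.compMultilinearMap_apply, hφ τ x]) fun x => ev_mem _ _ _
  have hFp := shuffle_vanishesOn hN hF
  have hsplit : splitRes e.incl p n N hN (shuffle e.proj π N p n hN F) = res e.proj p F :=
    splitRes_shuffle e.exact.apply_apply_eq_zero (LinearMap.congr_fun hπ) hN F
  refine ⟨_, hF, hFp, ?_, ?_⟩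
  · have h1 : N + 1 = p + (n + 1) := by omega
    rw [vanishesOn_succ_iff e h1 (ce_mem_CS ρ hF), splitRes_ce_of_vanishesOn hN h1 hF hFp, hsplit]
    ext1 x
    have h2 := (hσ (φ (e.proj ∘ x))).d_eq_zero (n + 1)
    have h3 := ev_d (restrictRep e ρ) n (σ (φ (e.proj ∘ x)))
    rw [h2, map_zero] at h3
    exact h3.symm
  · ext x
    rw [inducedML_apply, hsplit, res_apply]
    have h1 : e.proj ∘ s ∘ x = x := funext fun i => hs _
    rw [h1]
    exact hc _ _ (hσ (φ x))

/-- A cochain inducing zero is a coboundary modulo the next step of the filtration. -/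
theorem exists_sub_d_mem (hc : IsClassMap (restrictRep e ρ) n c) (hs : ∀ x, e.proj (s x) = x)
    {p N : ℕ} (hN : N = p + n) {f : (csComplex ρ).X N} (hfp : f ∈ (hsFiltration e ρ).F p N)
    (hd : (csComplex ρ).d N (N + 1) f ∈ (hsFiltration e ρ).F (p + 1) (N + 1))
    (h0 : inducedML c s p N hN (ev ρ N f) = 0) :
    ∃ (m : ℕ) (v : (csComplex ρ).X m), v ∈ (hsFiltration e ρ).F p m ∧
      f - (csComplex ρ).d m N v ∈ (hsFiltration e ρ).F (p + 1) N := by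
  have hf := ev_mem ρ N f
  change VanishesOn e p N (ev ρ N f) at hfp
  change VanishesOn e (p + 1) (N + 1) (ev ρ (N + 1) _) at hd
  rw [ev_d] at hd
  have hcls : ∀ x, c (splitRes e.incl p n N hN (ev ρ N f) x) = 0 := fun x => by
    rw [← hfp.inducedML_comp_proj hs, h0]
    rfl
  have hcoc := ce_splitRes_eq_zero hN hf hfp hd
  cases n with
  | zero =>
    -- For `n = 0` there are no coboundaries on `h`: the values of `splitRes f` are cocycles of
    -- class zero, hence zero, and no correction is needed.
    refine ⟨0, 0, zero_mem _, ?_⟩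
    rw [map_zero, sub_zero]
    refine (vanishesOn_succ_iff e hN hf).2 ?_
    ext1 x
    exact hc.eq_zero (hcoc x) (hcls x)
  | succ n =>
    obtain ⟨N, rfl⟩ : ∃ N', N = N' + 1 := ⟨p + n, by omega⟩
    have hN' : N = p + n := by omega
    obtain ⟨τ, hτ, hτ'⟩ := exists_primitive (restrictRep e ρ) n
    obtain ⟨π, hπ⟩ := e.incl.exists_leftInverse_of_injective
      (LinearMap.ker_eq_bot.2 e.incl_injective)
    -- The values of `splitRes f` are coboundaries on `h`. Their primitives under `τ`, taken on `q`
    -- through `s`, are extended by shuffles to the correcting cochain `v ∈ Fᵖ`.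
    let F : ML 𝔽 q (ML 𝔽 h M n) p :=
      τ.compMultilinearMap (res s p (splitRes e.incl p (n + 1) (N + 1) hN (ev ρ (N + 1) f)))
    have hF : shuffle e.proj π N p n hN' F ∈ CS 𝔽 g M N :=
      shuffle_mem_CS _ _ hN' (fun σ x => by
        simp only [F, LinearMap.compMultilinearMap_apply, res_apply]
        rw [← Function.comp_assoc, splitRes_symm _ hN hf]) fun x => hτ _
    have hFp := shuffle_vanishesOn hN' hF
    have hsplit : splitRes e.incl p n N hN' (shuffle e.proj π N p n hN' F) = res e.proj p F :=
      splitRes_shuffle e.exact.apply_apply_eq_zero (LinearMap.congr_fun hπ) hN' F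
    obtain ⟨v, hv⟩ := exists_ev_eq ρ hF
    refine ⟨N, v, by rw [← hv] at hFp; exact hFp, ?_⟩
    refine (vanishesOn_succ_iff e hN (ev_mem ρ _ _)).2 ?_
    rw [map_sub, ev_d, hv, map_sub, splitRes_ce_of_vanishesOn hN' hN hF hFp, hsplit, sub_eq_zero]
    ext1 x
    obtain ⟨b, hb, hbx⟩ := hc.exists_ce_eq (splitRes_mem_CS _ hN hf x) (hcoc x) (hcls x)
    have h1 : splitRes e.incl p (n + 1) (N + 1) hN (ev ρ (N + 1) f) (s ∘ e.proj ∘ x) =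
        splitRes e.incl p (n + 1) (N + 1) hN (ev ρ (N + 1) f) x :=
      hfp.splitRes_congr hN (funext fun i => hs _)
    simp only [F, LinearMap.compMultilinearMap_apply, res_apply]
    rw [h1, ← hbx, hτ' b hb]

variable (e ρ) in
theorem hsFiltration_isFirstQuadrant : (hsFiltration e ρ).IsFirstQuadrant where
  eq_top p n hp := by
    refine eq_top_iff.2 fun f _ x S hS => ?_
    have := S.card_le_univ
    rw [Fintype.card_fin] at this
    omega
  eq_bot p n hp := by
    refine eq_bot_iff.2 fun f hf => ?_
    rw [Submodule.mem_bot]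
    refine ev_injective ρ n ?_
    rw [map_zero]
    ext x
    exact hf x ∅ (by simp; omega) (by simp)

end HochschildSerre

/-! ### Identification of the second page -/

section SecondPage

variable {𝔽 : Type u} {h : Type vh} {g : Type vg} {q : Type vq} {M : Type w} [Field 𝔽]
  [AddCommGroup h] [Module 𝔽 h] [CommLieAlgebra 𝔽 h]
  [AddCommGroup g] [Module 𝔽 g] [CommLieAlgebra 𝔽 g]
  [AddCommGroup q] [Module 𝔽 q] [CommLieAlgebra 𝔽 q]
  [AddCommGroup M] [Module 𝔽 M]
  {e : CommLieExtension 𝔽 h g q} {ρ : CommLieRep 𝔽 g M} [CharP 𝔽 2]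
  {n : ℕ} {c : ML 𝔽 h M n →ₗ[𝔽] HS (restrictRep e ρ) n} {s : q →ₗ[𝔽] g}

/-- The map `f ↦ inducedML f`, between symmetric cochains. -/
noncomputable def induced (c : ML 𝔽 h M n →ₗ[𝔽] HS (restrictRep e ρ) n) (s : q →ₗ[𝔽] g)
    (p N : ℕ) (hN : N = p + n) : (csComplex ρ).X N →ₗ[𝔽] (csComplex (quotRep e ρ n)).X p :=
  ((inducedML c s p N hN ∘ₗ ev ρ N).codRestrict (CS 𝔽 q (HS (restrictRep e ρ) n) p)
    fun f => inducedML_mem_CS c s hN (ev_mem ρ N f) :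
      (csComplex ρ).X N →ₗ[𝔽] CS 𝔽 q (HS (restrictRep e ρ) n) p)

theorem ev_induced {p N : ℕ} (hN : N = p + n) (f : (csComplex ρ).X N) :
    ev (quotRep e ρ n) p (induced c s p N hN f) = inducedML c s p N hN (ev ρ N f) := rfl

theorem induced_eq_zero_iff {p N : ℕ} (hN : N = p + n) (f : (csComplex ρ).X N) :
    induced c s p N hN f = 0 ↔ inducedML c s p N hN (ev ρ N f) = 0 := by
  rw [← ev_induced, map_eq_zero_iff _ (ev_injective (quotRep e ρ n) p)]

theorem induced_eq_zero_of_mem {p N : ℕ} (hN : N = p + n) {f : (csComplex ρ).X N}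
    (hf : f ∈ (hsFiltration e ρ).F (p + 1) N) : induced c s p N hN f = 0 := by
  rw [induced_eq_zero_iff]
  ext x
  rw [inducedML_apply, (vanishesOn_succ_iff e hN (ev_mem ρ N f)).1 hf]
  exact map_zero c

/-- The split form of `dv` has values that are coboundaries on `h`, of class zero. -/
theorem induced_d_eq_zero_of_mem (hc : IsClassMap (restrictRep e ρ) n c) {p m N : ℕ}
    (hN : N = p + n) {v : (csComplex ρ).X m} (hv : v ∈ (hsFiltration e ρ).F p m) :
    induced c s p N hN ((csComplex ρ).d m N v) = 0 := by
  by_cases hm : m + 1 = N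
  · subst hm
    rw [induced_eq_zero_iff, ev_d]
    ext x
    rw [inducedML_apply]
    cases n with
    | zero =>
      -- For `n = 0` the degree of `v` is `p - 1`, where `Fᵖ` vanishes.
      rw [(hsFiltration_isFirstQuadrant e ρ).eq_bot _ _ (by omega), Submodule.mem_bot] at hv
      rw [hv, map_zero, map_zero, map_zero]
      exact map_zero c
    | succ n =>
      have hm : m = p + n := by omega
      rw [splitRes_ce_of_vanishesOn hm hN (ev_mem ρ m v) hv, LinearMap.compMultilinearMap_apply,
        hc.apply_ce (splitRes_mem_CS _ _ (ev_mem ρ m v) _)]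
      rfl
  · rw [(csComplex ρ).shape m N hm]
    exact map_zero _

theorem induced_d (hc : IsClassMap (restrictRep e ρ) n c) (hs : ∀ x, e.proj (s x) = x)
    {p N : ℕ} (hN : N = p + n) (hN' : N + 1 = p + 1 + n) {f : (csComplex ρ).X N}
    (hf : f ∈ (hsFiltration e ρ).Z 1 p N) :
    induced c s (p + 1) (N + 1) hN' ((csComplex ρ).d N (N + 1) f) =
      (csComplex (quotRep e ρ n)).d p (p + 1) (induced c s p N hN f) := by
  refine ev_injective (quotRep e ρ n) (p + 1) ?_
  have hd : VanishesOn e (p + 1) (N + 1) (ev ρ (N + 1) ((csComplex ρ).d N (N + 1) f)) := hf.2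
  rw [ev_d] at hd
  rw [ev_induced, ev_d, ev_d, ev_induced, inducedML_ce hc hs hN hN' (ev_mem ρ N f) hf.1 hd]

theorem exists_induced_eq (hc : IsClassMap (restrictRep e ρ) n c) (hs : ∀ x, e.proj (s x) = x)
    {p N : ℕ} (hN : N = p + n) (φ : (csComplex (quotRep e ρ n)).X p) :
    ∃ f ∈ (hsFiltration e ρ).Z 1 p N, induced c s p N hN f = φ := by
  obtain ⟨f, hf, hfp, hd, hφ⟩ := exists_inducedML_eq hc hs hN (ev_mem (quotRep e ρ n) p φ)
  obtain ⟨f, rfl⟩ := exists_ev_eq ρ hf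
  rw [← ev_d] at hd
  exact ⟨f, ⟨hfp, hd⟩, ev_injective (quotRep e ρ n) p hφ⟩

/-- Write `f = (f - dv) + dv` with `v ∈ Fᵖ` and `f - dv ∈ Fᵖ⁺¹`. As `d(f - dv) = df ∈ Fᵖ⁺²`, the
first term is in `Z₁ᵖ⁺¹`; and `v ∈ Z₁ᵖ⁻¹` because `dv ∈ Fᵖ`. -/
theorem mem_B_two_of_induced_eq_zero (hc : IsClassMap (restrictRep e ρ) n c)
    (hs : ∀ x, e.proj (s x) = x) {p N : ℕ} (hN : N = p + n) {f : (csComplex ρ).X N}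
    (hf : f ∈ (hsFiltration e ρ).Z 2 p N) (h0 : induced c s p N hN f = 0) :
    f ∈ (hsFiltration e ρ).B 2 p N := by
  obtain ⟨m, v, hv, hfv⟩ := exists_sub_d_mem hc hs hN hf.1
    (Filtration.anti _ _ _ _ (by omega) hf.2) ((induced_eq_zero_iff hN f).1 h0)
  refine (Filtration.mem_B _).2 ⟨_, (Filtration.mem_Z _).2 ⟨hfv, ?_⟩, m, v,
    (Filtration.mem_Z _).2 ⟨Filtration.anti _ _ _ _ (by omega) hv,
      Filtration.anti _ _ p _ (by omega) (Filtration.d_mem _ _ _ _ _ hv)⟩,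
    (sub_add_cancel _ _).symm⟩
  rw [map_sub, Filtration.d_d_apply, sub_zero]
  exact Filtration.anti _ _ _ _ (by omega) hf.2

/-- Lift `φ` to `f ∈ Z₁`. Then `df` induces `dφ = 0`, so `df - dv' ∈ Fᵖ⁺²` for some `v' ∈ Fᵖ⁺¹`;
subtracting `v'` from `f` leaves the induced cochain unchanged. -/
theorem exists_mem_Z_two (hc : IsClassMap (restrictRep e ρ) n c) (hs : ∀ x, e.proj (s x) = x)
    {p N : ℕ} (hN : N = p + n) {φ : (csComplex (quotRep e ρ n)).X p}
    (hφ : (csComplex (quotRep e ρ n)).d p (p + 1) φ = 0) :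
    ∃ f ∈ (hsFiltration e ρ).Z 2 p N, induced c s p N hN f = φ := by
  obtain ⟨f, hf, rfl⟩ := exists_induced_eq hc hs hN φ
  have hN' : N + 1 = p + 1 + n := by omega
  rw [← induced_d hc hs hN hN' hf, induced_eq_zero_iff] at hφ
  obtain ⟨m, v, hv, hfv⟩ := exists_sub_d_mem hc hs hN' hf.2
    (by rw [Filtration.d_d_apply]; exact zero_mem _) hφ
  obtain ⟨v', hv', hvv'⟩ : ∃ v' ∈ (hsFiltration e ρ).F (p + 1) N,
      (csComplex ρ).d N (N + 1) v' = (csComplex ρ).d m (N + 1) v := by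
    by_cases hm : m = N
    · subst hm
      exact ⟨v, hv, rfl⟩
    · refine ⟨0, zero_mem _, ?_⟩
      rw [(csComplex ρ).shape m (N + 1) (by simpa using hm), map_zero]
      rfl
  refine ⟨f - v', (Filtration.mem_Z _).2
    ⟨sub_mem hf.1 (Filtration.anti _ _ _ _ (by omega) hv'), ?_⟩, ?_⟩
  · rw [map_sub, hvv']
    exact Filtration.anti _ _ _ _ (by push_cast; omega) hfv
  · rw [map_sub, induced_eq_zero_of_mem hN hv', sub_zero]

/-- The summand `Z₁ᵖ⁺¹` induces zero and `dZ₁ᵖ⁻¹` induces coboundaries. Conversely, a primitive of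
the induced cochain lifts to `w ∈ Z₁ᵖ⁻¹`, and `f - dw` induces zero. -/
theorem mem_B_two_iff (hc : IsClassMap (restrictRep e ρ) n c) (hs : ∀ x, e.proj (s x) = x)
    {p N : ℕ} (hN : N = p + n) {f : (csComplex ρ).X N} (hf : f ∈ (hsFiltration e ρ).Z 2 p N) :
    f ∈ (hsFiltration e ρ).B 2 p N ↔
      ∃ (m : ℕ) (ψ : (csComplex (quotRep e ρ n)).X m),
        (csComplex (quotRep e ρ n)).d m p ψ = induced c s p N hN f := by
  constructor
  · intro h
    obtain ⟨a, ha, m, b, hb, rfl⟩ := (Filtration.mem_B _).1 h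
    rw [map_add, induced_eq_zero_of_mem hN ha.1, zero_add]
    rcases p with _ | p
    -- For `p = 0` there is no column `p - 1`; but `b` lies in `F⁰`, the whole complex, so `db`
    -- induces zero.
    · refine ⟨0, 0, ?_⟩
      rw [map_zero, induced_d_eq_zero_of_mem hc]
      rw [(hsFiltration_isFirstQuadrant e ρ).eq_top _ _ (by simp)]
      trivial
    · by_cases hm : m + 1 = N
      · subst hm
        have hm : m = p + n := by omega
        refine ⟨p, induced c s p m hm b, ?_⟩
        rw [induced_d hc hs hm hN]
        exact Filtration.Z_mono _ (by push_cast; omega) (by push_cast; omega) _ hb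
      · refine ⟨0, 0, ?_⟩
        rw [(csComplex ρ).shape m N hm, map_zero]
        exact (map_zero _).symm
  · rintro ⟨m, ψ, hψ⟩
    by_cases hm : m + 1 = p
    · subst hm
      obtain ⟨N, rfl⟩ : ∃ N', N = N' + 1 := ⟨m + n, by omega⟩
      have hN' : N = m + n := by omega
      obtain ⟨w, hw, rfl⟩ := exists_induced_eq hc hs hN' ψ
      have h1 : (csComplex ρ).d N (N + 1) w ∈ (hsFiltration e ρ).B 2 (m + 1 : ℕ) (N + 1) :=
        (Filtration.mem_B _).2 ⟨0, zero_mem _, N, w,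
          Filtration.Z_mono _ (by push_cast; omega) (by push_cast; omega) _ hw, (zero_add _).symm⟩
      have h2 : f - (csComplex ρ).d N (N + 1) w ∈ (hsFiltration e ρ).B 2 (m + 1 : ℕ) (N + 1) := by
        refine mem_B_two_of_induced_eq_zero hc hs hN ((Filtration.mem_Z _).2 ⟨?_, ?_⟩) ?_
        · exact sub_mem hf.1 (Filtration.d_mem_F _ rfl (by push_cast; rfl) hw)
        · rw [map_sub, Filtration.d_d_apply, sub_zero]
          exact hf.2
        · rw [map_sub, induced_d hc hs hN' hN hw, hψ, sub_self]
      simpa using add_mem h2 h1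
    · rw [(csComplex (quotRep e ρ n)).shape m p hm] at hψ
      exact mem_B_two_of_induced_eq_zero hc hs hN hf hψ.symm

theorem isInducedCochain_induced (hc : IsClassMap (restrictRep e ρ) n c)
    (hs : ∀ x, e.proj (s x) = x) {p : ℕ} {f : (csComplex ρ).X (p + n)}
    (hf : f ∈ (hsFiltration e ρ).Z 1 p (p + n)) :
    IsInducedCochain e ρ p n f (induced c s p (p + n) rfl f) := by
  intro x
  obtain ⟨w, hw⟩ := exists_ev_eq (restrictRep e ρ)
    (splitRes_mem_CS e.incl rfl (ev_mem ρ (p + n) f) x)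
  have hd : VanishesOn e (p + 1) (p + n + 1) (ev ρ (p + n + 1) ((csComplex ρ).d _ _ f)) := hf.2
  rw [ev_d] at hd
  have hcoc := ce_splitRes_eq_zero rfl (ev_mem ρ (p + n) f) hf.1 hd x
  refine ⟨w, fun y => ?_, ?_⟩
  · rw [hw, splitRes_apply]
    rfl
  · rw [ev_induced, VanishesOn.inducedML_comp_proj hs rfl hf.1, ← hw]
    exact hc.isClassOf (by rw [hw, hcoc])

variable (e ρ) in
/-- `E₂^{p,n} ≅ HSᵖ(q, HSⁿ(h, M))`, induced by restriction of cochains. -/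
theorem exists_page_two_equiv (p n : ℕ) :
    ∃ ε : ((hsFiltration e ρ).page 2).X (p, n) ≃ₗ[𝔽] HS (quotRep e ρ n) p,
      ∀ z : (hsFiltration e ρ).Z 2 p (p + n), ∃ φ : (csComplex (quotRep e ρ n)).X p,
        IsInducedCochain e ρ p n z φ ∧
          IsClassOf (csComplex (quotRep e ρ n)) p φ
            (ε ((hsFiltration e ρ).toPage 2 (p, n) z)) := by
  obtain ⟨c, hc⟩ := exists_isClassMap (restrictRep e ρ) n
  obtain ⟨s, hs'⟩ := e.proj.exists_rightInverse_of_surjective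
    (LinearMap.range_eq_top.2 e.proj_surjective)
  have hs : ∀ x, e.proj (s x) = x := LinearMap.congr_fun hs'
  have hZ : (hsFiltration e ρ).Z 2 p (p + n) ≤ (hsFiltration e ρ).Z 1 p (p + n) :=
    Filtration.Z_mono _ le_rfl (by omega) _
  have hd : ∀ (z : (hsFiltration e ρ).Z 2 p (p + n)) (j : ℕ),
      (csComplex (quotRep e ρ n)).d p j (induced c s p (p + n) rfl z) = 0 := by
    intro z j
    by_cases hj : p + 1 = j
    · subst hj
      have h1 : p + n + 1 = p + 1 + n := by omega
      rw [← induced_d hc hs rfl h1 (hZ z.2)]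
      -- The level `p + 2` of `dz` is one more than an induced cochain of degree `p + 1` can detect.
      refine induced_eq_zero_of_mem h1 ?_
      exact Filtration.d_mem_F _ rfl (by push_cast; omega) z.2
    · rw [(csComplex (quotRep e ρ n)).shape p j hj]
      rfl
  obtain ⟨ψ, hψ⟩ := exists_lift_cycles (csComplex (quotRep e ρ n))
    (induced c s p (p + n) rfl ∘ₗ ((hsFiltration e ρ).Z 2 p (p + n)).subtype) hd
  let χ : (hsFiltration e ρ).Z 2 p (p + n) →ₗ[𝔽] HS (quotRep e ρ n) p :=
    ((csComplex (quotRep e ρ n)).homologyπ p).hom ∘ₗ ψ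
  have hχ : ∀ z : (hsFiltration e ρ).Z 2 p (p + n),
      IsClassOf (csComplex (quotRep e ρ n)) p (induced c s p (p + n) rfl z) (χ z) :=
    fun z => ⟨ψ z, hψ z, rfl⟩
  have hsurj : Function.Surjective χ := by
    intro a
    obtain ⟨φ, hφ⟩ := isClassOf_surjective a
    obtain ⟨f, hf, rfl⟩ := exists_mem_Z_two hc hs rfl (hφ.d_eq_zero (p + 1))
    exact ⟨⟨f, hf⟩, (hχ _).unique hφ⟩
  have hker : ∀ z : (hsFiltration e ρ).Z 2 p (p + n), χ z = 0 ↔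
      (z : (csComplex ρ).X (p + n)) ∈ (hsFiltration e ρ).B 2 p (p + n) := fun z => by
    rw [(hχ z).eq_zero_iff, mem_B_two_iff hc hs rfl z.2]
  refine ⟨quotEquiv _ _ χ hsurj hker, fun z =>
    ⟨_, isInducedCochain_induced hc hs (hZ z.2), ?_⟩⟩
  exact (quotEquiv_mk _ _ χ hsurj hker z).symm ▸ hχ z

end SecondPage

/-! ### Assembly of the spectral sequence -/

namespace Filtration

variable {𝔽 : Type u} [Field 𝔽] {K : CochainComplex (ModuleCat.{w} 𝔽) ℕ} {Φ : Filtration K}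

/-- The spectral sequence of a filtration of first quadrant type. -/
noncomputable def IsFirstQuadrant.spectralSequence (hΦ : Φ.IsFirstQuadrant) :
    CohomologicalSpectralSequenceNat (ModuleCat.{w} 𝔽) 0 where
  page r _ := Φ.page r
  iso r r' pq hrr' hr := (hΦ.exists_homology_iso hr pq).choose.toModuleIso ≪≫
    eqToIso (by rw [hrr'])

end Filtration

end CommLie

theorem mainTheorem3
    {𝔽 : Type u} {h : Type vh} {g : Type vg} {q : Type vq} {M : Type w} [Field 𝔽] [CharP 𝔽 2]
    [AddCommGroup h] [Module 𝔽 h] [CommLieAlgebra 𝔽 h]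
    [AddCommGroup g] [Module 𝔽 g] [CommLieAlgebra 𝔽 g]
    [AddCommGroup q] [Module 𝔽 q] [CommLieAlgebra 𝔽 q]
    [AddCommGroup M] [Module 𝔽 M]
    (e : CommLieExtension 𝔽 h g q) (ρ : CommLieRep 𝔽 g M) :
    -- a first quadrant cohomological spectral sequence starting at `E₀` ...
    ∃ (E : CohomologicalSpectralSequenceNat (ModuleCat.{max vg w} 𝔽) 0)
      -- ... whose pages are those of the filtration by the number of arguments in `h`, ...
      (α : ∀ (r : ℤ) (hr : 0 ≤ r), E.page r hr ≅ (CommLie.hsFiltration e ρ).page r),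
      -- ... the isomorphisms `H(E_r) ≅ E_{r+1}` being the identity on representatives,
      (∀ (r : ℤ) (hr : 0 ≤ r) (pq : ℕ × ℕ)
          (z : (CommLie.csComplex ρ).X (pq.1 + pq.2))
          (hz : z ∈ (CommLie.hsFiltration e ρ).Z r pq.1 (pq.1 + pq.2))
          (hz' : z ∈ (CommLie.hsFiltration e ρ).Z (r + 1) pq.1 (pq.1 + pq.2))
          (k : (E.page r hr).cycles pq),
          (α r hr).hom.f pq ((E.page r hr).iCycles pq k) =
              (CommLie.hsFiltration e ρ).toPage r pq ⟨z, hz⟩ →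
            (α (r + 1) (by omega)).hom.f pq
                ((E.iso r (r + 1) pq rfl hr).hom ((E.page r hr).homologyπ pq k)) =
              (CommLie.hsFiltration e ρ).toPage (r + 1) pq ⟨z, hz'⟩) ∧
      -- `E₂^{p,n} ≅ HSᵖ(q, HSⁿ(h, M))`, by restriction of cochains,
      (∀ p n : ℕ, ∃ ε : (E.page 2 (by norm_num)).X (p, n) ≃ₗ[𝔽]
          CommLie.HS (CommLie.quotRep e ρ n) p,
        ∀ (a : (E.page 2 (by norm_num)).X (p, n))
          (z : (CommLie.hsFiltration e ρ).Z 2 p (p + n)),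
          (α 2 (by norm_num)).hom.f (p, n) a = (CommLie.hsFiltration e ρ).toPage 2 (p, n) z →
            ∃ φ : (CommLie.csComplex (CommLie.quotRep e ρ n)).X p,
              CommLie.IsInducedCochain e ρ p n z φ ∧
              CommLie.IsClassOf (CommLie.csComplex (CommLie.quotRep e ρ n)) p φ (ε a)) ∧
      -- convergence to `HS^•(g, M)`: the induced filtration of `HSⁿ(g, M)` is finite, ...
      (∀ n : ℕ, (CommLie.hsFiltration e ρ).FH 0 n = ⊤ ∧
        (CommLie.hsFiltration e ρ).FH (n + 1) n = ⊥) ∧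
      -- ... and its graded pieces are the stable values `E_r^{p,n}`, `r > max(p, n + 1)`.
      (∀ (p n : ℕ) (r : ℤ) (hr : 0 ≤ r), (p : ℤ) < r → (n : ℤ) + 1 < r →
        ∃ ε : (E.page r hr).X (p, n) ≃ₗ[𝔽] (CommLie.hsFiltration e ρ).grH p (p + n),
          ∀ (a : (E.page r hr).X (p, n)) (z : (CommLie.hsFiltration e ρ).Z r p (p + n)),
            (α r hr).hom.f (p, n) a = (CommLie.hsFiltration e ρ).toPage r (p, n) z →
              ∃ b : (CommLie.hsFiltration e ρ).FH p (p + n),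
                CommLie.IsClassOf (CommLie.csComplex ρ) (p + n) z b ∧
                ε a = Submodule.Quotient.mk b) := by
  have hΦ := CommLie.hsFiltration_isFirstQuadrant e ρ
  refine ⟨hΦ.spectralSequence, fun r _ => Iso.refl _, ?_, ?_, ?_, ?_⟩
  · intro r hr pq z hz hz' k hk
    -- With `r' = r + 1` by `rfl`, the transport in `iso` is the identity, leaving the property of
    -- the chosen isomorphism.
    exact (hΦ.exists_homology_iso hr pq).choose_spec z hz hz' k hk
  · intro p n
    obtain ⟨ε, hε⟩ := CommLie.exists_page_two_equiv e ρ p n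
    refine ⟨ε, fun a z ha => ?_⟩
    obtain ⟨φ, hφ, hφ'⟩ := hε z
    exact ⟨φ, hφ, (show a = _ from ha) ▸ hφ'⟩
  · exact fun n => ⟨hΦ.FH_zero n, hΦ.FH_succ n⟩
  · intro p n r hr hp hn
    obtain ⟨ε, hε⟩ := hΦ.exists_page_equiv_grH p n r hp hn
    refine ⟨ε, fun a z ha => ?_⟩
    obtain ⟨b, hb, hb'⟩ := hε z
    exact ⟨b, hb, (show a = _ from ha) ▸ hb'⟩
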